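/- Conventions: all rings are commutative. An algebra $B$ over a ring $K$ is \emph{essentially of finite type} if it is a localization of some finitely generated $K$-algebra. If $K$ is a field, $B$ is \emph{essentially smooth over $K$} if, in addition, the ring $B\otimes_K K'$ is regular for every field extension $K\subseteq K'$. A module $M$ over a ring $R$ is \emph{essentially of finite type} if there exist an $R$-algebra $A$ essentially of finite type and a finite $A$-module structure on $M$ such that the $R$-module structure induced through $R\to A$ coincides with the original one. Theorem. Let $R$ be an essentially smooth algebra over a field, and let $M$ and $N$ be $R$-modules essentially of finite type. If $\operatorname{Tor}_i^R(M,N)=0$ for some $i\ge 0$, then $\operatorname{Tor}_j^R(M,N)=0$ for each $j\ge i$. -/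

import Mathlib

open CategoryTheory
open scoped TensorProduct

universe u v

/-- An algebra `B` over a field `K` is essentially smooth if it is essentially of finite type
(a localization of a finitely generated `K`-algebra) and `B ⊗[K] K'` is a regular ring for every
field extension `K'` of `K`. The extensions range over a universe containing both `K` and `B`;
neither `K` nor the extensions are assumed algebraic, finite, perfect, etc. -/
structure IsEssentiallySmooth (K : Type v) (B : Type u) [Field K] [CommRing B] [Algebra K B] :
    Prop where
  essFiniteType : Algebra.EssFiniteType K B
  isRegularRing_tensorProduct : ∀ (K' : Type (max u v)) [Field K'] [Algebra K K'],
    IsRegularRing (B ⊗[K] K')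

/-- An `R`-module `M` is essentially of finite type if there are an `R`-algebra `A` essentially of
finite type and a finite `A`-module structure on `M` inducing, through `R → A`, the given
`R`-module structure. -/
def IsEssentiallyOfFiniteType (R : Type u) [CommRing R] (M : Type u) [AddCommGroup M]
    [Module R M] : Prop :=
  ∃ (A : Type u) (_ : CommRing A) (_ : Algebra R A) (_ : Module A M),
    Algebra.EssFiniteType R A ∧ Module.Finite A M ∧ IsScalarTower R A M

section

open scoped Pointwise
open IsLocalRing RingTheory.Sequence

/-! The proof is reduction to the diagonal. Let `M` be finite over `A` and `N` finite over `E`, both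
algebras essentially of finite type over `K`. Replacing an algebra `B` that acts on `N` by `R ⊗[K]
B`, one may take `E` free over `R`. A resolution `P` of `N` by finite free `E`-modules is then
`R`-free and computes Tor. The complex `M ⊗[R] P` is the quotient of `M ⊗[K] P` by `J`, the
extension to `A ⊗[K] E` of the kernel `I` of multiplication `R ⊗[K] R → R`. Over the field `K`, the
complex `M ⊗[K] P` is exact in positive degrees.

Smoothness enters through `IsEssentiallySmooth.exists_isWeaklyRegular_localization`. At a prime `p ⊇
I` over `q`, the closed fiber of `R_q → (R ⊗[K] R)_p` is a localization of `κ(q) ⊗[K] R`, hence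
regular local, and `I` maps onto its maximal ideal. Lifts of a regular system of parameters generate
`I` at `p` and, by a fiber criterion, are weakly regular on the base change of every `R`-module.
Since `P n` is `R`-free, `M ⊗[K] P n` is a sum of copies of the base change of `M`, so the sequence
is weakly regular there too.

Finally, rigidity survives division by a regular element `x` of the Jacobson radical
(`IsRigidSequence.of_exact_smul`): `H_i(X)/x` embeds in `H_i(X/x)`, so Nakayama and the long exact
sequence apply. Exactness is tested at maximal ideals of `A ⊗[K] E`; away from `J` the quotient
vanishes. -/

/-! ### Minimal generators of the maximal ideal -/

/-- The class of `x` in the cotangent space is nonzero, so it extends to a basis chosen among the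
classes of `t`; Nakayama lifts the basis to generators. -/
theorem IsLocalRing.exists_list_generators {F : Type*} [CommRing F] [IsLocalRing F]
    [IsNoetherianRing F] (t : Set F) (ht : Ideal.span t = maximalIdeal F)
    (x : F) (hx : x ∈ t) (hx2 : x ∉ (maximalIdeal F) ^ 2) :
    ∃ xs : List F, (∀ y ∈ xs, y ∈ t) ∧ Ideal.ofList (x :: xs) = maximalIdeal F ∧
      (x :: xs).length = (maximalIdeal F).spanFinrank := by
  classical
  have htm : t ⊆ maximalIdeal F := ht ▸ Ideal.subset_span
  let v : maximalIdeal F → CotangentSpace F := (maximalIdeal F).toCotangent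
  let t' : Set (maximalIdeal F) := Subtype.val ⁻¹' t
  let x' : maximalIdeal F := ⟨x, htm hx⟩
  have hvx : v x' ≠ 0 := by
    intro h
    exact hx2 ((Ideal.toCotangent_eq_zero _ _).1 h)
  have h0 : LinearIndepOn (ResidueField F) v {x'} := by
    simpa [LinearIndepOn] using hvx
  obtain ⟨b, hbt, hxb, hspan, hli⟩ := exists_linearIndepOn_extension h0
    (t := t') (by simpa [t', x'] using hx)
  have hspan' : Submodule.span F t' = ⊤ := by
    apply (Submodule.map_injective_of_injective (maximalIdeal F).injective_subtype)
    rw [Submodule.map_span, Submodule.map_top, Submodule.range_subtype]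
    have : ((maximalIdeal F).subtype '' t') = t := by
      ext z; simpa [t'] using fun hz => htm hz
    rw [this]; exact ht
  have htop : Submodule.span (ResidueField F) (v '' b) = ⊤ := by
    rw [eq_top_iff, ← (CotangentSpace.span_image_eq_top_iff (s := t')).2 hspan']
    exact Submodule.span_le.2 hspan
  have hbspan := (CotangentSpace.span_image_eq_top_iff (s := b)).1 htop
  have hfin : b.Finite := by
    have : Finite b := hli.finite
    exact Set.toFinite b
  have hcard : b.ncard = (maximalIdeal F).spanFinrank := by
    rw [spanFinrank_maximalIdeal_eq_finrank_cotangentSpace]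
    let B := Module.Basis.mk hli (by rw [← Set.image_eq_range v b]; exact htop.ge)
    rw [Module.finrank_eq_nat_card_basis B]
    rfl
  let l := (hfin.toFinset.erase x').toList
  have hmem : ∀ y, y ∈ l ↔ y ≠ x' ∧ y ∈ b := by simp [l]
  refine ⟨l.map Subtype.val, ?_, ?_, ?_⟩
  · intro y hy
    obtain ⟨z, hz, rfl⟩ := List.mem_map.1 hy
    exact hbt ((hmem z).1 hz).2
  · have : (maximalIdeal F) = Ideal.span ((maximalIdeal F).subtype '' b) := by
      have := congrArg (Submodule.map (maximalIdeal F).subtype) hbspan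
      rw [Submodule.map_span, Submodule.map_top, Submodule.range_subtype] at this
      exact this.symm
    refine Eq.trans ?_ this.symm
    rw [Ideal.ofList]
    congr 1
    ext z
    simp only [List.mem_cons, List.mem_map, hmem, Set.mem_ofPred_eq, Set.mem_image]
    constructor
    · rintro (rfl | ⟨a, ⟨-, ha⟩, rfl⟩)
      · exact ⟨x', hxb rfl, rfl⟩
      · exact ⟨a, ha, rfl⟩
    · rintro ⟨a, ha, rfl⟩
      by_cases h : a = x'
      · left; rw [h]; rfl
      · right; exact ⟨a, ⟨h, ha⟩, rfl⟩
  · rw [← hcard, Set.ncard_eq_toFinset_card b hfin]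
    have hx' : x' ∈ hfin.toFinset := by simpa using hxb rfl
    simp only [l, List.length_cons, List.length_map, Finset.length_toList]
    rw [Finset.card_erase_of_mem hx']
    have := Finset.card_pos.2 ⟨x', hx'⟩
    omega

theorem IsLocalRing.maximalIdeal_eq_bot_of_le_sq {F : Type*} [CommRing F] [IsLocalRing F]
    [IsNoetherianRing F] (h : maximalIdeal F ≤ maximalIdeal F ^ 2) : maximalIdeal F = ⊥ := by
  refine Submodule.eq_bot_of_le_smul_of_le_jacobson_bot (maximalIdeal F) _
    (IsNoetherian.noetherian _) (by rwa [smul_eq_mul, ← pow_two]) ?_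
  rw [IsLocalRing.jacobson_eq_maximalIdeal ⊥ bot_ne_top]

theorem IsLocalRing.exists_list_generators_of_span {F : Type*} [CommRing F] [IsLocalRing F]
    [IsNoetherianRing F] (t : Set F) (ht : Ideal.span t = maximalIdeal F) :
    ∃ xs : List F, (∀ y ∈ xs, y ∈ t) ∧ Ideal.ofList xs = maximalIdeal F ∧
      xs.length = (maximalIdeal F).spanFinrank := by
  by_cases h : t ⊆ (maximalIdeal F ^ 2 : Ideal F)
  · have := maximalIdeal_eq_bot_of_le_sq (ht.symm.trans_le (Ideal.span_le.2 h))
    exact ⟨[], by simp, by simp [this],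
      ((Submodule.spanFinrank_eq_zero_iff_eq_bot (IsNoetherian.noetherian _)).2 this).symm⟩
  · obtain ⟨x, hx, hx2⟩ := Set.not_subset.1 h
    obtain ⟨xs, h1, h2, h3⟩ := exists_list_generators t ht x hx hx2
    exact ⟨x :: xs, by simpa using ⟨hx, h1⟩, h2, h3⟩

theorem Ideal.spanFinrank_ofList_le {F : Type*} [CommRing F] (xs : List F) :
    (Ideal.ofList xs).spanFinrank ≤ xs.length := by
  classical
  have : (Ideal.ofList xs).spanFinrank ≤ ({r | r ∈ xs} : Set F).ncard :=
    Submodule.spanFinrank_span_le_ncard_of_finite xs.finite_toSet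
  refine this.trans ?_
  have : ({r | r ∈ xs} : Set F) = (xs.toFinset : Set F) := by ext; simp
  rw [this, Set.ncard_coe_finset]
  exact xs.toFinset_card_le

/-! ### Regular local rings are domains, and regular systems of parameters are regular sequences -/

namespace IsRegularLocalRing

variable {F : Type u} [CommRing F]

/-- Dividing by one element lowers the dimension by at most one, while `xs` still generates the
maximal ideal. Hence the embedding dimension of the quotient is at most `xs.length`, which is at
most its dimension, and all three agree. -/
theorem quotient_span_singleton [IsRegularLocalRing F] {x : F} {xs : List F}
    (h : Ideal.ofList (x :: xs) = maximalIdeal F)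
    (hlen : (x :: xs).length = (maximalIdeal F).spanFinrank) :
    ∃ _ : IsRegularLocalRing (F ⧸ Ideal.span {x}),
      Ideal.ofList (xs.map (algebraMap F (F ⧸ Ideal.span {x}))) =
        maximalIdeal (F ⧸ Ideal.span {x}) ∧
      xs.length = (maximalIdeal (F ⧸ Ideal.span {x})).spanFinrank := by
  have hx : x ∈ maximalIdeal F := h ▸ Ideal.subset_span (by simp)
  have hle : Ideal.span {x} ≤ maximalIdeal F := by simpa [Ideal.span_le] using hx
  have hne : Ideal.span {x} ≠ ⊤ := fun h => (maximalIdeal.isMaximal F).ne_top (top_le_iff.1 (h ▸ hle))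
  have : Nontrivial (F ⧸ Ideal.span {x}) := Ideal.Quotient.nontrivial_iff.2 hne
  have : IsLocalRing (F ⧸ Ideal.span {x}) :=
    .of_surjective' (Ideal.Quotient.mk _) Ideal.Quotient.mk_surjective
  have hm : Ideal.ofList (xs.map (algebraMap F (F ⧸ Ideal.span {x}))) =
        maximalIdeal (F ⧸ Ideal.span {x}) := by
    rw [← Ideal.map_ofList]
    rw [← map_maximalIdeal_of_surjective (Ideal.Quotient.mk (Ideal.span {x}))
      Ideal.Quotient.mk_surjective, ← h, Ideal.ofList_cons, Ideal.map_sup]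
    have : Ideal.map (Ideal.Quotient.mk (Ideal.span {x})) (Ideal.span {x}) = ⊥ := Ideal.map_quotient_self _
    rw [this, bot_sup_eq]
    rfl
  have h1 : (maximalIdeal (F ⧸ Ideal.span {x})).spanFinrank ≤ xs.length := by
    rw [← hm]
    simpa using Ideal.spanFinrank_ofList_le (xs.map (algebraMap F (F ⧸ Ideal.span {x})))
  have h2 := ringKrullDim_le_ringKrullDim_quotient_add_spanFinrank (R := F) (Ideal.span {x})
    (by rwa [IsLocalRing.ringJacobson_eq_maximalIdeal])
  have h3 : (Ideal.span {x}).spanFinrank ≤ 1 := by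
    simpa using Ideal.spanFinrank_ofList_le [x]
  have h4 : (xs.length : WithBot ℕ∞) ≤ ringKrullDim (F ⧸ Ideal.span {x}) := by
    rw [← IsRegularLocalRing.spanFinrank_maximalIdeal, ← hlen] at h2
    have h5 : ((xs.length + 1 : ℕ) : WithBot ℕ∞) ≤ ringKrullDim (F ⧸ Ideal.span {x}) + 1 :=
      h2.trans (by gcongr; exact_mod_cast h3)
    push_cast at h5
    exact (ENat.WithBot.add_le_add_one_right_iff).1 h5
  have hreg : IsRegularLocalRing (F ⧸ Ideal.span {x}) :=
    .of_spanFinrank_maximalIdeal_le _ (le_trans (by exact_mod_cast h1) h4)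
  refine ⟨hreg, hm, le_antisymm ?_ h1⟩
  rw [← hreg.spanFinrank_maximalIdeal] at h4
  exact_mod_cast h4

/-- Prime avoidance gives `x` in the maximal ideal, outside its square and outside every minimal
prime. By induction `(x)` is prime; a minimal prime `p ⊆ (x)` omits `x`, so `p = x p` and Nakayama
gives `p = 0`. -/
theorem isDomain_of_spanFinrank_eq (n : ℕ) : ∀ (F : Type u) [CommRing F] [IsRegularLocalRing F],
    (maximalIdeal F).spanFinrank = n → IsDomain F := by
  induction n with
  | zero =>
    intro F _ _ h
    have : maximalIdeal F = ⊥ :=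
      (Submodule.spanFinrank_eq_zero_iff_eq_bot (IsNoetherian.noetherian _)).1 h
    exact (isField_iff_maximalIdeal_eq.2 this).isDomain
  | succ n ih =>
    intro F _ _ h
    have hfin := minimalPrimes.finite_of_isNoetherianRing F
    -- The square is listed twice because the form of prime avoidance used below has two slots for
    -- ideals that need not be prime.
    have hne : ¬ ((maximalIdeal F : Set F) ⊆ ((maximalIdeal F ^ 2 : Ideal F) : Set F) ∪
        ((maximalIdeal F ^ 2 : Ideal F) : Set F) ∪ ⋃ i ∈ (hfin.toFinset : Set (Ideal F)), (i : Set F)) := by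
      have hm2 : ¬ maximalIdeal F ≤ maximalIdeal F ^ 2 := by
        intro hle
        have := maximalIdeal_eq_bot_of_le_sq hle
        rw [← Submodule.spanFinrank_eq_zero_iff_eq_bot (IsNoetherian.noetherian _)] at this
        omega
      intro hsub
      rw [Ideal.subset_union_prime' (f := fun i : Ideal F => i)] at hsub
      · rcases hsub with h | h | ⟨p, hp, h⟩
        · exact hm2 h
        · exact hm2 h
        · have hp' : p ∈ minimalPrimes F := by simpa using hp
          have hpp : p.IsPrime := hp'.1.1
          have hpm : p = maximalIdeal F := le_antisymm (le_maximalIdeal hpp.ne_top) h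
          -- A maximal ideal that is also a minimal prime has height zero, but the dimension is `n +
          -- 1`.
          have h0 : (maximalIdeal F).height = 0 := by
            rw [← hpm]
            exact Ideal.height_eq_zero_iff.2 hp'
          have h1 := IsLocalRing.maximalIdeal_height_eq_ringKrullDim (R := F)
          rw [h0, ← IsRegularLocalRing.spanFinrank_maximalIdeal, ‹(maximalIdeal F).spanFinrank = n + 1›] at h1
          have h2 : (0 : ℕ) = n + 1 := by exact_mod_cast h1
          omega
      · intro i hi
        have : i ∈ minimalPrimes F := by simpa using hi
        exact this.1.1
    obtain ⟨x, hx, hx'⟩ := Set.not_subset.1 hne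
    simp only [Set.mem_union, not_or, Set.mem_iUnion, not_exists] at hx'
    obtain ⟨⟨hx2, -⟩, hxp⟩ := hx'
    obtain ⟨xs, -, hxs, hlen⟩ := exists_list_generators (maximalIdeal F : Set F) (by simp) x hx hx2
    obtain ⟨hreg, -, hl⟩ := quotient_span_singleton hxs hlen
    have hdom : IsDomain (F ⧸ Ideal.span {x}) := ih _ (by
      rw [← hl]; simp only [List.length_cons] at hlen; omega)
    have hprime : (Ideal.span {x}).IsPrime := (Ideal.Quotient.isDomain_iff_prime _).1 hdom
    obtain ⟨p, hp, hpx⟩ := Ideal.exists_minimalPrimes_le (I := (⊥ : Ideal F)) (J := Ideal.span {x}) bot_le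
    have hpp : p.IsPrime := hp.1.1
    have hxp' : x ∉ p := hxp p (by simpa [minimalPrimes] using hp)
    have hle : p ≤ maximalIdeal F • p := by
      intro y hy
      obtain ⟨a, rfl⟩ := Ideal.mem_span_singleton'.1 (hpx hy)
      have : a ∈ p := (hpp.mem_or_mem hy).resolve_right hxp'
      rw [mul_comm]
      exact Submodule.smul_mem_smul hx this
    have hbot : p = ⊥ := by
      refine Submodule.eq_bot_of_le_smul_of_le_jacobson_bot (maximalIdeal F) _
        (IsNoetherian.noetherian _) hle ?_
      rw [IsLocalRing.jacobson_eq_maximalIdeal ⊥ bot_ne_top]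
    rw [hbot] at hpp
    exact IsDomain.of_bot_isPrime F

instance (priority := low) isDomain [IsRegularLocalRing F] : IsDomain F :=
  isDomain_of_spanFinrank_eq _ F rfl

theorem isWeaklyRegular (xs : List F) [IsRegularLocalRing F]
    (h : Ideal.ofList xs = maximalIdeal F)
    (hlen : xs.length = (maximalIdeal F).spanFinrank) : IsWeaklyRegular F xs := by
  induction hn : xs.length generalizing F with
  | zero => rw [List.length_eq_zero_iff.1 hn]; exact .nil _ _
  | succ n ih =>
    obtain _ | ⟨x, xs⟩ := xs
    · simp at hn
    obtain ⟨hreg, hm, hl⟩ := quotient_span_singleton h hlen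
    -- If `x` were zero, the shorter list `xs` would already generate the maximal ideal.
    have hx0 : x ≠ 0 := by
      rintro rfl
      have : Ideal.ofList xs = maximalIdeal F := by
        rw [← h, Ideal.ofList_cons]; simp
      have := this ▸ Ideal.spanFinrank_ofList_le xs
      simp only [List.length_cons] at hlen
      omega
    refine .cons (fun a b hab => ?_) ?_
    · exact mul_left_cancel₀ hx0 hab
    · have := ih (F := F ⧸ Ideal.span {x}) (xs.map (algebraMap F (F ⧸ Ideal.span {x}))) hm
        (by simpa using hl) (by simpa using hn)
      rw [isWeaklyRegular_map_algebraMap_iff] at this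
      refine (LinearEquiv.isWeaklyRegular_congr
        (Submodule.quotEquivOfEq _ _ ?_) xs).1 this
      ext y
      rw [Submodule.mem_smul_pointwise_iff_exists, Ideal.mem_span_singleton']
      simp [mul_comm]

end IsRegularLocalRing

/-! ### Quotients by one element, tensor products and flatness -/

section QuotTensor

variable {R S T : Type*} [CommRing R] [CommRing S] [Algebra R S] [AddCommGroup T] [Module R T]
  [Module S T] [IsScalarTower R S T] {Q : Type*} [AddCommGroup Q] [Module R Q] [Module S Q]
  [IsScalarTower R S Q] (M : Type*) [AddCommGroup M] [Module R M]

theorem TensorProduct.exact_smul_rTensor {x : S} {q : T →ₗ[S] Q} (hq : Function.Surjective q)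
    (h : Function.Exact (fun t : T => x • t) q) :
    Function.Exact (fun z : T ⊗[R] M => x • z) ((q.restrictScalars R).rTensor M) := by
  have h : Function.Exact (Algebra.lsmul R R T x) (q.restrictScalars R) := h
  have := rTensor_exact M h hq
  convert! this using 1

noncomputable def QuotSMulTop.equivOfExact {x : S} {q : T →ₗ[S] Q} (hq : Function.Surjective q)
    (h : Function.Exact (fun t : T => x • t) q) : QuotSMulTop x T ≃ₗ[S] Q :=
  (Submodule.quotEquivOfEq _ _ (by
    ext z
    rw [LinearMap.mem_ker, h z, Submodule.mem_smul_pointwise_iff_exists]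
    simp)).trans (LinearMap.quotKerEquivOfSurjective q hq)

theorem QuotSMulTop.exact_mkQ (x : S) :
    Function.Exact (fun t : T => x • t) (x • (⊤ : Submodule S T)).mkQ := by
  intro t
  simp [Submodule.mem_smul_pointwise_iff_exists]

noncomputable def QuotSMulTop.tensorEquiv {x : S} {q : T →ₗ[S] Q} (hq : Function.Surjective q)
    (h : Function.Exact (fun t : T => x • t) q) :
    QuotSMulTop x (T ⊗[R] M) ≃ₗ[S] Q ⊗[R] M :=
  QuotSMulTop.equivOfExact (q := TensorProduct.AlgebraTensorModule.map q (LinearMap.id : M →ₗ[R] M))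
    (LinearMap.rTensor_surjective M (g := q.restrictScalars R) hq)
    (TensorProduct.exact_smul_rTensor M hq h)

end QuotTensor

section

variable {R : Type u} {S T : Type*} [CommRing R] [CommRing S] [Algebra R S] [AddCommGroup T] [Module R T]
  [Module S T] [IsScalarTower R S T]

theorem LinearMap.lTensor_smul_of_tower {M N : Type*} [AddCommGroup M] [Module R M] [AddCommGroup N]
    [Module R N] (f : M →ₗ[R] N) (x : S) (z : T ⊗[R] M) : f.lTensor T (x • z) = x • f.lTensor T z := by
  induction z with
  | zero => simp
  | add a b ha hb => simp only [smul_add, map_add, ha, hb]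
  | tmul a b => simp [TensorProduct.smul_tmul']

/-- A chase through the tensors of `I → R → R ⧸ I` with `T` and `Q = T/xT`: regularity of `x` on
each `T ⊗ R ⧸ I` is what makes `Q ⊗ I → Q` injective once `T` is flat. -/
theorem Module.Flat.of_exact_smul [Module.Flat R T] {Q : Type*} [AddCommGroup Q] [Module R Q]
    [Module S Q] [IsScalarTower R S Q] {x : S} {q : T →ₗ[S] Q} (hq : Function.Surjective q)
    (hxq : Function.Exact (fun t : T => x • t) q)
    (h : ∀ I : Ideal R, IsSMulRegular (T ⊗[R] (R ⧸ I)) x) : Module.Flat R Q := by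
  rw [Module.Flat.iff_lTensor_injective']
  intro I
  rw [injective_iff_map_eq_zero]
  intro w hw
  let qR := q.restrictScalars R
  obtain ⟨w', rfl⟩ := LinearMap.rTensor_surjective I (g := qR) hq w
  have h1 : qR.rTensor R (I.subtype.lTensor T w') = 0 := by
    rw [← hw]
    exact LinearMap.congr_fun ((LinearMap.rTensor_comp_lTensor _ _ _).trans
      (LinearMap.lTensor_comp_rTensor _ _ _).symm) w'
  obtain ⟨u', hu'⟩ := (TensorProduct.exact_smul_rTensor R hq hxq _).1 h1
  have hI : Function.Exact I.subtype (Submodule.mkQ I) := fun r => by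
    simpa using Ideal.Quotient.eq_zero_iff_mem
  have hex := _root_.lTensor_exact T hI (Submodule.mkQ_surjective _)
  have h2 : x • (Submodule.mkQ I).lTensor T u' = 0 := by
    rw [← LinearMap.lTensor_smul_of_tower]
    exact (congrArg _ hu').trans (hex.apply_apply_eq_zero w')
  obtain ⟨v, rfl⟩ := (hex u').1 (h I (by simpa using h2))
  have h3 : w' = x • v := by
    apply Module.Flat.lTensor_preserves_injective_linearMap (M := T) I.subtype I.injective_subtype
    rw [LinearMap.lTensor_smul_of_tower]
    exact hu'.symm
  rw [h3]
  exact ((TensorProduct.exact_smul_rTensor I hq hxq _).2 ⟨v, rfl⟩)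

end

/-! ### Regularity on the closed fiber implies regularity on every base change -/

section FiberCriterion

variable {R : Type u} {S T : Type*} [CommRing R] [CommRing S] [Algebra R S] [AddCommGroup T] [Module R T]
  [Module S T] [IsScalarTower R S T]

/-- Over the field `R ⧸ m` the module `V` is free, so `T ⊗ V` is a direct sum of copies of the
fiber. -/
theorem IsSMulRegular.tensor_of_quotient_maximal (m : Ideal R) [m.IsMaximal] {x : S}
    (h : IsSMulRegular (T ⊗[R] (R ⧸ m)) x)
    (V : Type*) [AddCommGroup V] [Module R V] [Module (R ⧸ m) V] [IsScalarTower R (R ⧸ m) V] :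
    IsSMulRegular (T ⊗[R] V) x := by
  let := Ideal.Quotient.field m
  let b := Module.Free.chooseBasis (R ⧸ m) V
  let e : T ⊗[R] V ≃ₗ[S] T ⊗[R] (_ →₀ (R ⧸ m)) :=
    TensorProduct.AlgebraTensorModule.congr (.refl S T) (b.repr.restrictScalars R)
  let e' := e.trans (TensorProduct.finsuppRight R S T (R ⧸ m) _)
  rw [e'.isSMulRegular_congr]
  intro f g hfg
  ext i
  exact h (by simpa using congrArg (fun f => f i) hfg)

variable [IsLocalRing R] [IsLocalRing S] [IsNoetherianRing S]
  [IsLocalHom (algebraMap R S)] [Module.Flat R T] {x : S}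

omit [IsLocalRing S] [IsNoetherianRing S] [IsLocalHom (algebraMap R S)]
  [Module.Flat R T] in
theorem mem_range_lTensor_of_smul_eq_zero
    (h : IsSMulRegular (T ⊗[R] (R ⧸ maximalIdeal R)) x)
    (M : Type*) [AddCommGroup M] [Module R M] (z : T ⊗[R] M) (hz : x • z = 0) :
    z ∈ LinearMap.range ((maximalIdeal R • (⊤ : Submodule R M)).subtype.lTensor T) := by
  have hex := lTensor_exact T (f := (maximalIdeal R • (⊤ : Submodule R M)).subtype)
    (g := Submodule.mkQ (maximalIdeal R • (⊤ : Submodule R M))) (by intro r; rw [Submodule.coe_subtype, Subtype.range_coe]; simp) (Submodule.mkQ_surjective _)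
  refine (hex z).1 ?_
  apply h.tensor_of_quotient_maximal (V := M ⧸ (maximalIdeal R • (⊤ : Submodule R M)))
  simp [← LinearMap.lTensor_smul_of_tower, hz]

omit [IsLocalRing S] [IsNoetherianRing S] [IsLocalHom (algebraMap R S)] in
-- An element killed by `x` dies in `T ⊗ (M ⧸ mM)`, so it comes from `T ⊗ mM`. By flatness its lift
-- is also killed by `x`, and the induction hypothesis for the module `mM` gains one power. This is
-- why `M` varies in the induction.
theorem mem_pow_smul_top_of_smul_eq_zero
    (h : IsSMulRegular (T ⊗[R] (R ⧸ maximalIdeal R)) x) (n : ℕ) :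
    ∀ (M : Type v) [AddCommGroup M] [Module R M] (z : T ⊗[R] M) (_ : x • z = 0),
      z ∈ ((maximalIdeal R).map (algebraMap R S)) ^ n • (⊤ : Submodule S (T ⊗[R] M)) := by
  induction n with
  | zero => simp
  | succ n ih =>
    intro M _ _ z hz
    obtain ⟨z', hzz'⟩ := mem_range_lTensor_of_smul_eq_zero h M z hz
    let N := (maximalIdeal R • (⊤ : Submodule R M))
    have hz' : x • z' = 0 := by
      apply Module.Flat.lTensor_preserves_injective_linearMap (M := T) N.subtype N.injective_subtype
      rw [LinearMap.lTensor_smul_of_tower, hzz', hz, map_zero]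
    have h1 := ih N z' hz'
    let f : T ⊗[R] N →ₗ[S] T ⊗[R] M := TensorProduct.AlgebraTensorModule.map .id N.subtype
    have h2 : f z' ∈ ((maximalIdeal R).map (algebraMap R S)) ^ n •
        (((maximalIdeal R).map (algebraMap R S)) • (⊤ : Submodule S (T ⊗[R] M))) := by
      have h3 := Submodule.mem_map_of_mem (f := f) h1
      rw [Submodule.map_smul''] at h3
      refine Submodule.smul_mono le_rfl ?_ h3
      rintro _ ⟨y, -, rfl⟩
      induction y with
      | zero => simp
      | add a b ha hb => rw [map_add]; exact add_mem ha hb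
      | tmul t y =>
        obtain ⟨y, hy⟩ := y
        change t ⊗ₜ[R] y ∈ _
        refine Submodule.smul_induction_on hy ?_ ?_
        · intro r hr y _
          rw [TensorProduct.tmul_smul, ← algebraMap_smul S r]
          exact Submodule.smul_mem_smul (Ideal.mem_map_of_mem _ hr) trivial
        · intro a b ha hb
          rw [TensorProduct.tmul_add]; exact add_mem ha hb
    rw [← mul_smul, ← pow_succ] at h2
    exact hzz' ▸ h2

omit [IsLocalRing R] [IsLocalRing S] [IsNoetherianRing S]
  [IsLocalHom (algebraMap R S)] [Module.Flat R T] in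
theorem Module.Finite.tensor_of_tower [Module.Finite S T] (M : Type*) [AddCommGroup M]
    [Module R M] [Module.Finite R M] : Module.Finite S (T ⊗[R] M) := by
  obtain ⟨n, f, hf⟩ := Module.Finite.exists_fin' R M
  have : Module.Finite S (T ⊗[R] (Fin n → R)) :=
    .equiv (TensorProduct.piScalarRight R S T (Fin n)).symm
  exact .of_surjective (TensorProduct.AlgebraTensorModule.map (.id : T →ₗ[S] T) f)
    (LinearMap.lTensor_surjective T hf)

/-- For finite `M`, Krull's intersection theorem kills an element lying in all powers. In general an
element of the tensor product comes from a finite submodule of `M`, and flatness keeps the inclusion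
injective. -/
theorem IsSMulRegular.tensor_of_fiber [Module.Finite S T]
    (h : IsSMulRegular (T ⊗[R] (R ⧸ maximalIdeal R)) x)
    (M : Type v) [AddCommGroup M] [Module R M] : IsSMulRegular (T ⊗[R] M) x := by
  have key : ∀ (M : Type v) [AddCommGroup M] [Module R M] [Module.Finite R M] (z : T ⊗[R] M)
      (_ : x • z = 0), z = 0 := by
    intro M _ _ _ z hz
    have : Module.Finite S (T ⊗[R] M) := .tensor_of_tower M
    have hbot := Ideal.iInf_pow_smul_eq_bot_of_isLocalRing (M := T ⊗[R] M)
      ((maximalIdeal R).map (algebraMap R S))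
      ((map_maximalIdeal_lt_top (algebraMap R S)).ne)
    rw [← Submodule.mem_bot S, ← hbot, Submodule.mem_iInf]
    exact fun n => mem_pow_smul_top_of_smul_eq_zero h n M z hz
  rw [isSMulRegular_iff_right_eq_zero_of_smul]
  intro z hz
  obtain ⟨N, hN, hzN⟩ := TensorProduct.exists_finite_submodule_right_of_setFinite {z} (Set.finite_singleton z)
  obtain ⟨z', rfl⟩ := hzN rfl
  rw [key N z', map_zero]
  apply Module.Flat.lTensor_preserves_injective_linearMap (M := T) N.subtype N.injective_subtype
  rw [LinearMap.lTensor_smul_of_tower, hz, map_zero]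

end FiberCriterion

/-- Stated for an `S`-module `T`, not only for `S`, so that the induction can replace `T` by `T/xT`,
which remains flat over `R`. -/
theorem RingTheory.Sequence.IsWeaklyRegular.tensor_of_fiber {R : Type u} {S : Type v} [CommRing R] [CommRing S] [Algebra R S]
    [IsLocalRing R] [IsLocalRing S] [IsNoetherianRing S]
    [IsLocalHom (algebraMap R S)] (xs : List S) {T : Type v} [AddCommGroup T] [Module R T]
    [Module S T] [IsScalarTower R S T] [Module.Flat R T] [Module.Finite S T]
    (h : IsWeaklyRegular (T ⊗[R] (R ⧸ maximalIdeal R)) xs)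
    (M : Type u) [AddCommGroup M] [Module R M] : IsWeaklyRegular (T ⊗[R] M) xs := by
  induction xs generalizing T with
  | nil => exact .nil _ _
  | cons x xs ih =>
    rw [isWeaklyRegular_cons_iff] at h ⊢
    refine ⟨h.1.tensor_of_fiber M, ?_⟩
    have hs : Function.Surjective (x • (⊤ : Submodule S T)).mkQ := Submodule.mkQ_surjective _
    have hex := QuotSMulTop.exact_mkQ (T := T) x
    have : Module.Flat R (QuotSMulTop x T) :=
      .of_exact_smul (T := T) hs hex fun I => h.1.tensor_of_fiber _
    rw [(QuotSMulTop.tensorEquiv _ hs hex).isWeaklyRegular_congr] at h ⊢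
    exact ih h.2

/-! ### Regular generators of the ideal of a section -/

section Section

variable {R : Type u} {S : Type v} [CommRing R] [CommRing S] [Algebra R S]

/-- Because `S = R + I`, an element of `mS` agrees modulo `mS · I` with the image of some `r ∈ m`.
If the element lies in `I`, so does that image, which is then zero. -/
theorem Ideal.map_algebraMap_inf_le_of_section (m : Ideal R) {I : Ideal S}
    (hsurj : ∀ s : S, ∃ r : R, s - algebraMap R S r ∈ I)
    (hinj : ∀ r : R, algebraMap R S r ∈ I → algebraMap R S r = 0) :
    m.map (algebraMap R S) ⊓ I ≤ m.map (algebraMap R S) * I := by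
  rintro z ⟨hz, hzI⟩
  have key : ∃ r ∈ m, z - algebraMap R S r ∈ m.map (algebraMap R S) * I := by
    clear hzI
    refine Submodule.span_induction ?_ ⟨0, m.zero_mem, by simp⟩ ?_ ?_ hz
    · rintro _ ⟨r, hr, rfl⟩
      exact ⟨r, hr, by simp⟩
    · rintro x y - - ⟨r, hr, hx⟩ ⟨r', hr', hy⟩
      exact ⟨r + r', m.add_mem hr hr', by
        rw [map_add, add_sub_add_comm]; exact add_mem hx hy⟩
    · rintro s x - ⟨r, hr, hx⟩
      obtain ⟨t, ht⟩ := hsurj s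
      refine ⟨r * t, m.mul_mem_right t hr, ?_⟩
      have : s • x - algebraMap R S (r * t) =
          s * (x - algebraMap R S r) + algebraMap R S r * (s - algebraMap R S t) := by
        rw [map_mul, smul_eq_mul]; ring
      rw [this]
      exact add_mem (Ideal.mul_mem_left _ _ hx)
        (Ideal.mul_mem_mul (Ideal.mem_map_of_mem _ hr) ht)
  obtain ⟨r, hr, h⟩ := key
  have hrI : algebraMap R S r ∈ I := by
    have h' : z - algebraMap R S r ∈ I :=
      (Ideal.mul_le_right : m.map (algebraMap R S) * I ≤ I) h
    rw [← sub_sub_cancel z (algebraMap R S r)]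
    exact I.sub_mem hzI h'
  rwa [hinj r hrI, sub_zero] at h

variable [IsLocalRing R] [IsLocalRing S] [IsNoetherianRing S] [IsLocalHom (algebraMap R S)]

/-- Here `F` is the closed fiber and `I` maps onto its maximal ideal. A regular system of parameters
of `F` taken from the image of `J` lifts to `xs`; it is the fiber criterion that makes `xs` weakly
regular on all base changes. -/
theorem IsLocalRing.exists_isWeaklyRegular_of_section [Module.Flat R S] {F : Type v} [CommRing F]
    [IsRegularLocalRing F] [Algebra S F] (hF : Function.Surjective (algebraMap S F))
    (hker : RingHom.ker (algebraMap S F) = (maximalIdeal R).map (algebraMap R S))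
    {I : Ideal S} (hI : I ≤ maximalIdeal S)
    (hsurj : ∀ s : S, ∃ r : R, s - algebraMap R S r ∈ I)
    (hinj : ∀ r : R, algebraMap R S r ∈ I → algebraMap R S r = 0)
    (J : Set S) (hJ : Ideal.span J = I) :
    ∃ xs : List S, (∀ x ∈ xs, x ∈ J) ∧ Ideal.ofList xs = I ∧
      ∀ (M : Type u) [AddCommGroup M] [Module R M], IsWeaklyRegular (S ⊗[R] M) xs := by
  have hmS : maximalIdeal S ≤ (maximalIdeal R).map (algebraMap R S) ⊔ I := by
    intro s hs
    obtain ⟨r, hr⟩ := hsurj s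
    have hr' : r ∈ maximalIdeal R := by
      rw [← maximalIdeal_comap (algebraMap R S)]
      simpa using (maximalIdeal S).sub_mem hs (hI hr)
    have := add_mem (Submodule.mem_sup_left (Ideal.mem_map_of_mem _ hr'))
      (Submodule.mem_sup_right hr : _ ∈ (maximalIdeal R).map (algebraMap R S) ⊔ I)
    simpa using this
  have hmF : Ideal.span (algebraMap S F '' J) = maximalIdeal F := by
    rw [← Ideal.map_span, hJ]
    rw [← map_maximalIdeal_of_surjective (algebraMap S F) hF]
    refine le_antisymm (Ideal.map_mono hI) ((Ideal.map_mono hmS).trans ?_)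
    rw [Ideal.map_sup, ← hker, (Ideal.map_eq_bot_iff_le_ker _).2 le_rfl, bot_sup_eq]
  obtain ⟨ys, hysJ, hys, hlen⟩ := exists_list_generators_of_span _ hmF
  have hlift : ∃ xs : List S, (∀ x ∈ xs, x ∈ J) ∧ xs.map (algebraMap S F) = ys := by
    clear hys hlen
    induction ys with
    | nil => exact ⟨[], by simp, rfl⟩
    | cons y ys ih =>
      obtain ⟨xs, h1, rfl⟩ := ih fun z hz => hysJ z (List.mem_cons_of_mem _ hz)
      obtain ⟨x, hx, rfl⟩ := hysJ y List.mem_cons_self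
      exact ⟨x :: xs, by simpa using ⟨hx, h1⟩, rfl⟩
  obtain ⟨xs, hxsJ, rfl⟩ := hlift
  have hxsI : Ideal.ofList xs ≤ I := by
    rw [← hJ]; exact Ideal.span_mono fun x hx => hxsJ x hx
  refine ⟨xs, hxsJ, le_antisymm hxsI ?_, ?_⟩
  -- Nakayama: modulo `xs`, an element of `I` lies in `mS ∩ I ⊆ mS · I`.
  · refine Submodule.le_of_le_smul_of_le_jacobson_bot (I := maximalIdeal S)
      (IsNoetherian.noetherian _) (IsLocalRing.jacobson_eq_maximalIdeal ⊥ bot_ne_top).ge ?_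
    intro y hy
    have h1 : algebraMap S F y ∈ (Ideal.ofList xs).map (algebraMap S F) := by
      rw [Ideal.map_ofList, hys, ← map_maximalIdeal_of_surjective (algebraMap S F) hF]
      exact Ideal.mem_map_of_mem _ (hI hy)
    obtain ⟨j, hj, hjy⟩ := (Ideal.mem_map_iff_of_surjective _ hF).1 h1
    have h2 : y - j ∈ (maximalIdeal R).map (algebraMap R S) := by
      rw [← hker, RingHom.mem_ker, map_sub, hjy, sub_self]
    have h3 := Ideal.map_algebraMap_inf_le_of_section (maximalIdeal R) hsurj hinj
      ⟨h2, I.sub_mem hy (hxsI hj)⟩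
    have h4 := Ideal.mul_mono_left (map_maximalIdeal_le (algebraMap R S)) h3
    have := add_mem (Submodule.mem_sup_left hj) (Submodule.mem_sup_right h4 :
      _ ∈ Ideal.ofList xs ⊔ maximalIdeal S • I)
    simpa using this
  · intro M _ _
    apply IsWeaklyRegular.tensor_of_fiber
    have hreg := IsRegularLocalRing.isWeaklyRegular _ hys (by simpa using hlen)
    rw [isWeaklyRegular_map_algebraMap_iff] at hreg
    let g : S ⊗[R] R →ₗ[S] F :=
      (Algebra.linearMap S F).comp (TensorProduct.AlgebraTensorModule.rid R S S).toLinearMap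
    have hex := lTensor_exact S (f := (maximalIdeal R).subtype)
      (g := Submodule.mkQ (maximalIdeal R))
      (fun r => by
        rw [Submodule.coe_subtype, Subtype.range_coe]; exact Submodule.Quotient.mk_eq_zero _) (Submodule.mkQ_surjective _)
    let π : S ⊗[R] R →ₗ[S] S ⊗[R] (R ⧸ maximalIdeal R) :=
      TensorProduct.AlgebraTensorModule.map .id (Submodule.mkQ (maximalIdeal R))
    have hπ : Function.Surjective π :=
      LinearMap.lTensor_surjective S (Submodule.mkQ_surjective (maximalIdeal R))
    have hg : Function.Surjective g := hF.comp (LinearEquiv.surjective _)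
    -- Both `F` and `S ⊗ (R ⧸ m)` are quotients of `S ⊗ R ≅ S` by `mS`.
    have hkk : LinearMap.ker g = LinearMap.ker π := by
      ext z
      obtain ⟨s, rfl⟩ := (TensorProduct.AlgebraTensorModule.rid R S S).symm.surjective z
      have h1 : (TensorProduct.AlgebraTensorModule.rid R S S).symm s ∈ LinearMap.ker g ↔
          s ∈ (maximalIdeal R).map (algebraMap R S) := by
        rw [← hker]
        simp [g]
      rw [h1]
      have h2 : (TensorProduct.AlgebraTensorModule.rid R S S).symm s ∈ LinearMap.ker π ↔
          (TensorProduct.AlgebraTensorModule.rid R S S).symm s ∈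
            Set.range ((maximalIdeal R).subtype.lTensor S) := hex _
      rw [h2]
      constructor
      · intro hs
        refine Submodule.span_induction ?_ ⟨0, by simp⟩ ?_ ?_ hs
        · rintro _ ⟨r, hr, rfl⟩
          refine ⟨1 ⊗ₜ ⟨r, hr⟩, ?_⟩
          simp [Algebra.algebraMap_eq_smul_one, TensorProduct.smul_tmul]
        · rintro x y - - ⟨a, ha⟩ ⟨b, hb⟩
          exact ⟨a + b, by rw [map_add, map_add, ha, hb]⟩
        · rintro x y - ⟨a, ha⟩
          exact ⟨x • a, by rw [LinearMap.lTensor_smul_of_tower, ha, map_smul]⟩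
      · rintro ⟨w, hw⟩
        rw [LinearEquiv.eq_symm_apply] at hw
        rw [← hw]
        clear hw
        induction w with
        | zero => simp
        | add a b ha hb => rw [map_add, map_add]; exact add_mem ha hb
        | tmul a b =>
          simp only [LinearMap.lTensor_tmul, Submodule.subtype_apply,
            TensorProduct.AlgebraTensorModule.rid_tmul]
          rw [Algebra.smul_def]
          exact Ideal.mul_mem_right _ _ (Ideal.mem_map_of_mem _ b.2)
    let e := (g.quotKerEquivOfSurjective hg).symm.trans
      ((Submodule.quotEquivOfEq _ _ hkk).trans (π.quotKerEquivOfSurjective hπ))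
    exact (e.isWeaklyRegular_congr xs).1 hreg

end Section

/-! ### The diagonal ideal of `R ⊗[K] R` -/

section Diagonal

variable (K : Type v) [Field K] (R : Type u) [CommRing R] [Algebra K R]

theorem IsEssentiallySmooth.isRegularRing_fiber (hR : IsEssentiallySmooth K R) (L : Type u)
    [Field L] [Algebra K L] : IsRegularRing (L ⊗[K] R) := by
  have := hR.isRegularRing_tensorProduct (ULift.{v} L)
  exact .of_ringEquiv ((Algebra.TensorProduct.comm K R (ULift.{v} L)).trans
    (Algebra.TensorProduct.congr ULift.algEquiv .refl)).toRingEquiv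

variable {K R}

theorem Algebra.TensorProduct.sub_lmul'_tmul_one_mem_ideal (s : R ⊗[K] R) :
    s - (Algebra.TensorProduct.lmul' K s) ⊗ₜ[K] (1 : R) ∈ KaehlerDifferential.ideal K R := by
  rw [KaehlerDifferential.ideal, RingHom.mem_ker]
  simp

/-- The comparison map to the fiber over the contraction of `p` to the first factor. -/
noncomputable abbrev toFiber (q : Ideal R) [q.IsPrime] : R ⊗[K] R →ₐ[K] q.ResidueField ⊗[K] R :=
  Algebra.TensorProduct.map (IsScalarTower.toAlgHom K R q.ResidueField) (AlgHom.id K R)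

noncomputable abbrev fiberToResidueField (q : Ideal R) [q.IsPrime] :
    q.ResidueField ⊗[K] R →ₐ[K] q.ResidueField :=
  Algebra.TensorProduct.lift (AlgHom.id K _) (IsScalarTower.toAlgHom K R q.ResidueField)
    (fun _ _ => Commute.all _ _)

theorem fiberToResidueField_toFiber (q : Ideal R) [q.IsPrime] (s : R ⊗[K] R) :
    fiberToResidueField q (toFiber q s) =
      algebraMap R q.ResidueField (Algebra.TensorProduct.lmul' K s) := by
  induction s with
  | zero => simp
  | add a b ha hb => simp only [map_add, ha, hb]
  | tmul a b => simp

/-- The kernel of `R → κ(q)` is `q`, and tensoring over the field `K` preserves this exactness. -/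
theorem mem_map_of_toFiber_eq_zero (q : Ideal R) [q.IsPrime] {s : R ⊗[K] R} (hs : toFiber q s = 0) :
    s ∈ q.map (algebraMap R (R ⊗[K] R)) := by
  have h : Function.Exact ((q.restrictScalars K).subtype)
      (IsScalarTower.toAlgHom K R q.ResidueField).toLinearMap := by
    intro r
    simp
  have h1 := Module.Flat.rTensor_exact (M := R) h
  obtain ⟨w, rfl⟩ := (h1 s).1 hs
  clear hs
  induction w with
  | zero => simp
  | add a b ha hb => rw [map_add]; exact add_mem ha hb
  | tmul a b =>
    have : (a : R) ⊗ₜ[K] b = algebraMap R (R ⊗[K] R) a * (1 ⊗ₜ b) := by simp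
    simp only [LinearMap.rTensor_tmul, Submodule.subtype_apply]
    rw [this]
    exact Ideal.mul_mem_right _ _ (Ideal.mem_map_of_mem _ a.2)

/-- Clears the denominators of the coefficients in `κ(q)`. -/
theorem exists_tmul_one_mul_eq_toFiber (q : Ideal R) [q.IsPrime] (g : q.ResidueField ⊗[K] R) :
    ∃ t ∉ q, ∃ a : R ⊗[K] R, toFiber q (t ⊗ₜ 1) * g = toFiber q a := by
  induction g with
  | zero => exact ⟨1, (Ideal.ne_top_iff_one q).1 (Ideal.IsPrime.ne_top ‹_›), 0, by simp⟩
  | add a b ha hb =>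
    obtain ⟨t, ht, a', ha⟩ := ha
    obtain ⟨t', ht', b', hb⟩ := hb
    refine ⟨t * t', fun h => (‹q.IsPrime›.mem_or_mem h).elim ht ht',
      (t' ⊗ₜ 1) * a' + (t ⊗ₜ 1) * b', ?_⟩
    have : (t * t') ⊗ₜ[K] (1 : R) = (t ⊗ₜ 1) * (t' ⊗ₜ 1) := by simp
    rw [this, map_add, map_mul, map_mul, map_mul, ← ha, ← hb]
    ring
  | tmul k r =>
    obtain ⟨a, b, hb, rfl⟩ := IsFractionRing.div_surjective (A := R ⧸ q) k
    obtain ⟨a, rfl⟩ := Ideal.Quotient.mk_surjective a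
    obtain ⟨b, rfl⟩ := Ideal.Quotient.mk_surjective b
    have hb' : b ∉ q := fun h => nonZeroDivisors.ne_zero hb (Ideal.Quotient.eq_zero_iff_mem.2 h)
    have hb0 : algebraMap R q.ResidueField b ≠ 0 := by
      rwa [Ne, Ideal.algebraMap_residueField_eq_zero]
    refine ⟨b, hb', a ⊗ₜ r, ?_⟩
    have h1 : ∀ c, algebraMap (R ⧸ q) q.ResidueField (Ideal.Quotient.mk q c) =
      algebraMap R q.ResidueField c := fun c => rfl
    simp only [h1, Algebra.TensorProduct.map_tmul, Algebra.TensorProduct.tmul_mul_tmul]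
    simp [mul_div_assoc', mul_div_cancel_left₀ _ hb0]

variable {p : Ideal (R ⊗[K] R)} [p.IsPrime]

omit [p.IsPrime] in
-- Modulo the diagonal ideal, `s` equals its product `μ(s)` placed in the first factor, so `p` is
-- determined by its contraction there.
theorem mem_iff_of_ideal_le (hp : KaehlerDifferential.ideal K R ≤ p) (s : R ⊗[K] R) :
    s ∈ p ↔ Algebra.TensorProduct.lmul' K s ∈ p.comap (algebraMap R (R ⊗[K] R)) := by
  have h := hp (Algebra.TensorProduct.sub_lmul'_tmul_one_mem_ideal s)
  rw [Ideal.mem_comap]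
  constructor
  · intro hs
    simpa using p.sub_mem hs h
  · intro hs
    simpa using p.add_mem hs h

theorem comap_toFiber_ker (hp : KaehlerDifferential.ideal K R ≤ p) :
    p = (RingHom.ker (fiberToResidueField (K := K)
      (p.comap (algebraMap R (R ⊗[K] R))))).comap
        (toFiber (p.comap (algebraMap R (R ⊗[K] R)))).toRingHom := by
  ext s
  rw [mem_iff_of_ideal_le hp, ← Ideal.algebraMap_residueField_eq_zero]
  exact (fiberToResidueField_toFiber _ s).symm.congr_left

/-- The section lemma is applied to `R_q → (R ⊗[K] R)_p`, where `q` is the contraction of `p` to the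
first factor; multiplication provides the section, and smoothness makes the closed fiber regular. -/
theorem IsEssentiallySmooth.exists_isWeaklyRegular_localization [IsNoetherianRing (R ⊗[K] R)]
    (hR : IsEssentiallySmooth K R) (hp : KaehlerDifferential.ideal K R ≤ p) :
    ∃ xs : List (R ⊗[K] R), (∀ x ∈ xs, x ∈ KaehlerDifferential.ideal K R) ∧
      (Ideal.ofList xs).map (algebraMap _ (Localization.AtPrime p)) =
        (KaehlerDifferential.ideal K R).map (algebraMap _ (Localization.AtPrime p)) ∧
      ∀ (M : Type u) [AddCommGroup M] [Module R M],
        IsWeaklyRegular (Localization.AtPrime p ⊗[R] M) xs := by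
  let q := p.comap (algebraMap R (R ⊗[K] R))
  let P := RingHom.ker (fiberToResidueField (K := K) q)
  have : P.IsPrime := RingHom.ker_isPrime _
  have := hR.isRegularRing_fiber (L := q.ResidueField)
  let S' := Localization.AtPrime p
  let F := Localization.AtPrime P
  let R' := Localization.AtPrime q
  let f : R' →+* S' := Localization.localRingHom q p (algebraMap R (R ⊗[K] R)) rfl
  let g : S' →+* F := Localization.localRingHom p P (toFiber q).toRingHom (comap_toFiber_ker hp)
  let : Algebra R' S' := f.toAlgebra
  let : Algebra S' F := g.toAlgebra
  have hf (r : R) : algebraMap R' S' (algebraMap R R' r) = algebraMap _ S' (r ⊗ₜ[K] (1 : R)) :=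
    Localization.localRingHom_to_map _ _ _ _ _
  have hg (s : R ⊗[K] R) : algebraMap S' F (algebraMap _ S' s) = algebraMap _ F (toFiber q s) :=
    Localization.localRingHom_to_map _ _ _ _ _
  have : IsScalarTower R R' S' := .of_algebraMap_eq fun r => (hf r).symm
  have : IsLocalHom (algebraMap R' S') := Localization.isLocalHom_localRingHom ..
  have hflat : Module.Flat R S' := .trans R (R ⊗[K] R) S'
  have : Module.Flat R' S' := (Module.flat_iff_of_isLocalization R' q.primeCompl _).2 hflat
  have hpP (s : R ⊗[K] R) : s ∈ p ↔ toFiber q s ∈ P := SetLike.ext_iff.1 (comap_toFiber_ker hp) s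
  have hF : Function.Surjective (algebraMap S' F) := by
    intro y
    obtain ⟨a, b, rfl⟩ := IsLocalization.exists_mk'_eq P.primeCompl y
    obtain ⟨t, ht, a', ha⟩ := exists_tmul_one_mul_eq_toFiber q a
    obtain ⟨t', ht', b', hb⟩ := exists_tmul_one_mul_eq_toFiber q b.1
    have htP := (hpP _).not.1 ht
    have htP' := (hpP _).not.1 ht'
    have hb' : b' ∉ p := by
      rw [hpP, ← hb]
      exact fun h => (‹P.IsPrime›.mem_or_mem h).elim htP' b.2
    let z : S' := IsLocalization.mk' S' (a' * (t' ⊗ₜ 1))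
      (⟨(t ⊗ₜ 1) * b', fun h => (‹p.IsPrime›.mem_or_mem h).elim ht hb'⟩ : p.primeCompl)
    have hz : z * algebraMap _ S' ((t ⊗ₜ 1) * b') = algebraMap _ S' (a' * (t' ⊗ₜ 1)) :=
      IsLocalization.mk'_spec _ _ _
    have hz' := congrArg (algebraMap S' F) hz
    simp only [map_mul, hg, ← ha, ← hb] at hz'
    have hu : IsUnit (algebraMap _ F (toFiber q (t ⊗ₜ[K] (1 : R)))) :=
      IsLocalization.map_units F (⟨_, htP⟩ : P.primeCompl)
    have hu' : IsUnit (algebraMap _ F (toFiber q (t' ⊗ₜ[K] (1 : R)))) :=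
      IsLocalization.map_units F (⟨_, htP'⟩ : P.primeCompl)
    refine ⟨z, IsLocalization.eq_mk'_iff_mul_eq.2 ((hu.mul hu').mul_left_cancel ?_)⟩
    linear_combination hz'
  have hker : RingHom.ker (algebraMap S' F) = (maximalIdeal R').map (algebraMap R' S') := by
    have hmap : (maximalIdeal R').map (algebraMap R' S') =
        (q.map (algebraMap R (R ⊗[K] R))).map (algebraMap _ S') := by
      rw [← Localization.AtPrime.map_eq_maximalIdeal, Ideal.map_map, Ideal.map_map]
      congr 1
      ext r
      exact hf r
    rw [hmap]
    -- If `a` dies in `F`, some `h ∉ P` kills its image in the fiber. Clearing the denominators of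
    -- `h` gives `b ∉ p` with `b * a` in the extension of `q`.
    apply le_antisymm
    · intro y hy
      obtain ⟨a, s, rfl⟩ := IsLocalization.exists_mk'_eq p.primeCompl y
      rw [IsLocalization.mk'_mem_iff, RingHom.mem_ker, hg,
        IsLocalization.map_eq_zero_iff P.primeCompl] at hy
      obtain ⟨h, hha⟩ := hy
      obtain ⟨t, ht, b, hb⟩ := exists_tmul_one_mul_eq_toFiber q h.1
      have hb' : b ∉ p := by
        rw [hpP, ← hb]
        exact fun hh => (‹P.IsPrime›.mem_or_mem hh).elim ((hpP _).not.1 ht) h.2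
      have hba : b * a ∈ q.map (algebraMap R (R ⊗[K] R)) := by
        apply mem_map_of_toFiber_eq_zero
        rw [map_mul, ← hb, mul_assoc, hha, mul_zero]
      rw [IsLocalization.mk'_mem_iff,
        IsLocalization.algebraMap_mem_map_algebraMap_iff p.primeCompl]
      exact ⟨b, hb', hba⟩
    · rw [Ideal.map_map, Ideal.map_le_iff_le_comap]
      intro r hr
      rw [Ideal.mem_comap, RingHom.mem_ker, RingHom.comp_apply, hg]
      have : toFiber q (algebraMap R (R ⊗[K] R) r) = 0 := by
        simp [(Ideal.algebraMap_residueField_eq_zero (I := q)).2 hr]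
      rw [this, map_zero]
  obtain ⟨ys, hys, hI, hreg⟩ := IsLocalRing.exists_isWeaklyRegular_of_section (R := R') (S := S')
    (F := F) hF hker
    (I := (KaehlerDifferential.ideal K R).map (algebraMap _ (Localization.AtPrime p)))
    (by
      rw [Ideal.map_le_iff_le_comap]
      exact hp.trans (Localization.AtPrime.under_maximalIdeal (I := p)).ge)
    (fun s => by
      obtain ⟨a, b, rfl⟩ := IsLocalization.exists_mk'_eq p.primeCompl s
      have hb := (mem_iff_of_ideal_le hp _).not.1 b.2
      let μ := Algebra.TensorProduct.lmul' K (S := R)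
      -- The localized multiplication map sends `a / b` to `μ a / μ b`, which is the required
      -- representative.
      let r : R' := IsLocalization.mk' R' (μ a) (⟨μ b, hb⟩ : q.primeCompl)
      refine ⟨r, ?_⟩
      have h1 : r * algebraMap R R' (μ b) = algebraMap R R' (μ a) := IsLocalization.mk'_spec _ _ _
      have h2 := congrArg (algebraMap R' S') h1
      rw [map_mul, hf, hf] at h2
      have hu : IsUnit (algebraMap _ S' (μ b ⊗ₜ[K] (1 : R))) :=
        IsLocalization.map_units S' (⟨_, hb⟩ : p.primeCompl)
      have hu' : IsUnit (algebraMap _ S' b.1) := IsLocalization.map_units S' b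
      rw [← Ideal.mul_unit_mem_iff_mem _ (hu.mul hu')]
      have h3 : (IsLocalization.mk' S' a b - algebraMap R' S' r) *
          (algebraMap _ S' (μ b ⊗ₜ[K] (1 : R)) * algebraMap _ S' b.1) =
          algebraMap _ S' ((μ b ⊗ₜ[K] (1 : R)) * (a - μ a ⊗ₜ 1) -
            (μ a ⊗ₜ[K] (1 : R)) * (b.1 - μ b ⊗ₜ 1)) := by
        have h4 := IsLocalization.mk'_spec S' a b
        simp only [map_mul, map_sub]
        linear_combination algebraMap _ S' (μ b ⊗ₜ[K] (1 : R)) * h4 - algebraMap _ S' b.1 * h2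
      rw [h3]
      exact Ideal.mem_map_of_mem _ (sub_mem
        (Ideal.mul_mem_left _ _ (Algebra.TensorProduct.sub_lmul'_tmul_one_mem_ideal a))
        (Ideal.mul_mem_left _ _ (Algebra.TensorProduct.sub_lmul'_tmul_one_mem_ideal b.1))))
    (fun r hr => by
      obtain ⟨r, t, rfl⟩ := IsLocalization.exists_mk'_eq q.primeCompl r
      have h1 := Ideal.mul_mem_right (algebraMap R' S' (algebraMap R R' t)) _ hr
      rw [← map_mul, IsLocalization.mk'_spec, hf,
        IsLocalization.algebraMap_mem_map_algebraMap_iff p.primeCompl] at h1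
      -- Applying multiplication to this relation shows that `μ u`, which lies outside `q`, kills
      -- `r`.
      obtain ⟨u, hu, hur⟩ := h1
      rw [KaehlerDifferential.ideal, RingHom.mem_ker] at hur
      have hu' := (mem_iff_of_ideal_le hp _).not.1 hu
      have : IsLocalization.mk' R' r t = 0 := by
        rw [IsLocalization.mk'_eq_zero_iff]
        refine ⟨⟨_, hu'⟩, ?_⟩
        simpa using hur
      rw [this, map_zero]) _ rfl
  have hlift : ∃ xs : List (R ⊗[K] R), (∀ x ∈ xs, x ∈ KaehlerDifferential.ideal K R) ∧
      xs.map (algebraMap _ S') = ys := by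
    clear hI hreg
    induction ys with
    | nil => exact ⟨[], by simp, rfl⟩
    | cons y ys ih =>
      obtain ⟨xs, h1, rfl⟩ := ih fun z hz => hys z (List.mem_cons_of_mem _ hz)
      obtain ⟨x, hx, rfl⟩ := hys y List.mem_cons_self
      exact ⟨x :: xs, by simpa using ⟨hx, h1⟩, rfl⟩
  obtain ⟨xs, hxs, rfl⟩ := hlift
  refine ⟨xs, hxs, by rw [Ideal.map_ofList, hI], fun M _ _ => ?_⟩
  have h1 := hreg (R' ⊗[R] M)
  let e : S' ⊗[R'] (R' ⊗[R] M) ≃ₗ[S'] S' ⊗[R] M :=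
    TensorProduct.AlgebraTensorModule.cancelBaseChange R R' S' S' M
  exact (isWeaklyRegular_map_algebraMap_iff S' (S' ⊗[R] M) xs).1 ((e.isWeaklyRegular_congr _).1 h1)

end Diagonal

/-! ### Rigid sequences under quotients and localization -/

section Rigid

variable {Λ : Type*} [CommRing Λ]

/-- A sequence of composable maps is rigid if exactness at one spot forces it at all later ones.
The spot `i` is the source `X (i + 1)` of `d i`. -/
def IsRigidSequence {X : ℕ → Type*} [∀ n, AddCommGroup (X n)] (d : ∀ n, X (n + 1) → X n) : Prop :=
  ∀ i, Function.Exact (d (i + 1)) (d i) → ∀ j, i ≤ j → Function.Exact (d (j + 1)) (d j)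

variable {X : ℕ → Type u} [∀ n, AddCommGroup (X n)] [∀ n, Module Λ (X n)]

theorem IsRigidSequence.of_exact_succ {d : ∀ n, X (n + 1) → X n}
    (h : ∀ n, Function.Exact (d (n + 2)) (d (n + 1))) : IsRigidSequence d := by
  intro i hi j hij
  obtain _ | j := j
  · obtain rfl : i = 0 := by omega
    exact hi
  · exact h j

/-- The long exact sequence of `0 → X → X → Q → 0`, chased by hand. Vanishing of `H_i(Q)` gives
`H_i(X) = x H_i(X)`, so `H_i(X) = 0` by Nakayama and `H_j(X) = 0` for `j ≥ i`. For `j > i`, `H_j(Q)`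
sits between `H_j(X)` and `H_{j-1}(X)`. -/
theorem IsRigidSequence.of_exact_smul [IsNoetherianRing Λ] [∀ n, Module.Finite Λ (X n)]
    {d : ∀ n, X (n + 1) →ₗ[Λ] X n} (hd : ∀ n z, d n (d (n + 1) z) = 0)
    (hrig : IsRigidSequence fun n => d n) {x : Λ} (hx : x ∈ Ideal.jacobson (⊥ : Ideal Λ))
    (hreg : ∀ n, IsSMulRegular (X n) x)
    {Q : ℕ → Type u} [∀ n, AddCommGroup (Q n)] [∀ n, Module Λ (Q n)] {d' : ∀ n, Q (n + 1) →ₗ[Λ] Q n}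
    {q : ∀ n, X n →ₗ[Λ] Q n} (hq : ∀ n, Function.Surjective (q n))
    (hxq : ∀ n, Function.Exact (fun t : X n => x • t) (q n))
    (hcomm : ∀ n z, d' n (q (n + 1) z) = q n (d n z)) : IsRigidSequence fun n => d' n := by
  have hdd' : ∀ n z, d' n (d' (n + 1) z) = 0 := by
    intro n z
    obtain ⟨z, rfl⟩ := hq _ z
    rw [hcomm, hcomm, hd, map_zero]
  intro i hi j hij
  -- Nakayama on cycles: each cycle is a boundary plus `x` times a cycle.
  have hker : LinearMap.ker (d i) ≤ LinearMap.range (d (i + 1)) := by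
    refine Submodule.le_of_le_smul_of_le_jacobson_bot (I := Ideal.span {x})
      (IsNoetherian.noetherian _) (by simpa [Ideal.span_le] using hx) ?_
    intro z hz
    rw [LinearMap.mem_ker] at hz
    obtain ⟨w, hw⟩ := (hi (q _ z)).1 (by
      change d' i (q (i + 1) z) = 0
      rw [hcomm, hz, map_zero])
    obtain ⟨w, rfl⟩ := hq _ w
    replace hw : q (i + 1) (z - d (i + 1) w) = 0 := by
      rw [map_sub, ← hcomm, sub_eq_zero]; exact hw.symm
    obtain ⟨t, ht⟩ := (hxq _ _).1 hw
    have ht' : x • t = z - d (i + 1) w := ht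
    have ht0 : d i t = 0 := by
      apply hreg i
      simp only
      rw [← map_smul, ht', map_sub, hz, hd, smul_zero, sub_zero]
    have hzt : z = d (i + 1) w + x • t := by rw [ht', add_sub_cancel]
    rw [hzt]
    exact Submodule.add_mem_sup ⟨w, rfl⟩
      (Submodule.smul_mem_smul (Ideal.mem_span_singleton_self x) ht0)
  have hex : ∀ j, i ≤ j → Function.Exact (d (j + 1)) (d j) := by
    refine hrig i fun z => ⟨fun hz => hker hz, ?_⟩
    rintro ⟨w, rfl⟩
    exact hd _ _
  obtain rfl | hlt := hij.eq_or_lt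
  · exact hi
  obtain ⟨j, rfl⟩ : ∃ k, j = k + 1 := ⟨j - 1, by omega⟩
  intro z
  refine ⟨fun hz => ?_, ?_⟩
  · obtain ⟨z, rfl⟩ := hq _ z
    replace hz : q (j + 1) (d (j + 1) z) = 0 := by rw [← hcomm]; exact hz
    obtain ⟨w, hw⟩ := (hxq _ _).1 hz
    have hw' : x • w = d (j + 1) z := hw
    have hw0 : d j w = 0 := by
      apply hreg j
      simp only
      rw [← map_smul, hw', hd, smul_zero]
    obtain ⟨v, hv⟩ := (hex j (by omega) w).1 hw0
    have h1 : d (j + 1) (z - x • v) = 0 := by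
      rw [map_sub, map_smul, hv, hw', sub_self]
    obtain ⟨u, hu⟩ := (hex (j + 1) (by omega) _).1 h1
    refine ⟨q _ u, ?_⟩
    change d' (j + 1 + 1) (q (j + 1 + 1 + 1) u) = _
    rw [hcomm, hu, map_sub, (hxq _ (x • v)).2 ⟨v, rfl⟩, sub_zero]
  · rintro ⟨w, rfl⟩
    exact hdd' _ _

/-- Divides by one element at a time. The final quotient is an arbitrary surjection `q` with
prescribed kernel, so `Q` stays fixed while `X` shrinks. -/
theorem IsRigidSequence.of_isWeaklyRegular [IsNoetherianRing Λ] (xs : List Λ)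
    (hxs : ∀ x ∈ xs, x ∈ Ideal.jacobson (⊥ : Ideal Λ))
    {Q : ℕ → Type u} [∀ n, AddCommGroup (Q n)] [∀ n, Module Λ (Q n)] {d' : ∀ n, Q (n + 1) →ₗ[Λ] Q n}
    {X : ℕ → Type u} [∀ n, AddCommGroup (X n)] [∀ n, Module Λ (X n)] [∀ n, Module.Finite Λ (X n)]
    {d : ∀ n, X (n + 1) →ₗ[Λ] X n} (hd : ∀ n z, d n (d (n + 1) z) = 0)
    (hrig : IsRigidSequence fun n => d n)
    (hreg : ∀ n, IsWeaklyRegular (X n) xs)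
    {q : ∀ n, X n →ₗ[Λ] Q n} (hq : ∀ n, Function.Surjective (q n))
    (hker : ∀ n, LinearMap.ker (q n) = Ideal.ofList xs • ⊤)
    (hcomm : ∀ n z, d' n (q (n + 1) z) = q n (d n z)) : IsRigidSequence fun n => d' n := by
  induction xs generalizing X with
  | nil =>
    have hinj : ∀ n, Function.Injective (q n) := fun n => by
      rw [← LinearMap.ker_eq_bot, hker]; simp
    have key : ∀ n, Function.Exact (d' (n + 1)) (d' n) ↔ Function.Exact (d (n + 1)) (d n) := by
      intro n
      let e (n : ℕ) := LinearEquiv.ofBijective (q n) ⟨hinj n, hq n⟩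
      exact (Function.Exact.iff_of_ladder_linearEquiv (e₁ := e (n + 2)) (e₂ := e (n + 1)) (e₃ := e n)
        (LinearMap.ext fun z => hcomm _ z) (LinearMap.ext fun z => hcomm _ z))
    intro i hi j hij
    exact (key j).2 (hrig i ((key i).1 hi) j hij)
  | cons x xs ih =>
    simp only [isWeaklyRegular_cons_iff] at hreg
    have h1 : ∀ n, Ideal.ofList (x :: xs) • (⊤ : Submodule Λ (X n)) =
        x • ⊤ ⊔ Ideal.ofList xs • ⊤ := fun n => by
      rw [Ideal.ofList_cons_smul]
    refine ih (fun y hy => hxs y (List.mem_cons_of_mem _ hy)) (X := fun n => QuotSMulTop x (X n))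
      (d := fun n => QuotSMulTop.map x (d n)) ?_ ?_ (fun n => (hreg n).2)
      (q := fun n => Submodule.liftQ _ (q n) (by rw [hker, h1]; exact le_sup_left)) ?_ ?_ ?_
    · intro n z
      obtain ⟨z, rfl⟩ := Submodule.mkQ_surjective _ z
      change (Submodule.mkQ _) (d n (d (n + 1) z)) = 0
      rw [hd, map_zero]
    · exact IsRigidSequence.of_exact_smul hd hrig (hxs x List.mem_cons_self) (fun n => (hreg n).1)
        (q := fun n => Submodule.mkQ _) (fun n => Submodule.mkQ_surjective _)
        (fun n => QuotSMulTop.exact_mkQ x) (fun n z => rfl)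
    · intro n y
      obtain ⟨z, rfl⟩ := hq n y
      exact ⟨Submodule.mkQ _ z, rfl⟩
    · intro n
      rw [Submodule.ker_liftQ, hker, h1, Submodule.map_sup, Submodule.map_smul'', Submodule.map_top,
        Submodule.range_mkQ, Submodule.mkQ_map_self, bot_sup_eq]
    · intro n z
      obtain ⟨z, rfl⟩ := Submodule.mkQ_surjective _ z
      exact hcomm n z

theorem IsRigidSequence.of_localization {Λ : Type u} [CommRing Λ] [IsNoetherianRing Λ]
    (J : Ideal Λ) {X : ℕ → Type u} [∀ n, AddCommGroup (X n)] [∀ n, Module Λ (X n)]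
    [∀ n, Module.Finite Λ (X n)]
    {d : ∀ n, X (n + 1) →ₗ[Λ] X n} (hd : ∀ n z, d n (d (n + 1) z) = 0)
    (hex : ∀ n, Function.Exact (d (n + 2)) (d (n + 1)))
    {Q : ℕ → Type u} [∀ n, AddCommGroup (Q n)] [∀ n, Module Λ (Q n)] {d' : ∀ n, Q (n + 1) →ₗ[Λ] Q n}
    {q : ∀ n, X n →ₗ[Λ] Q n} (hq : ∀ n, Function.Surjective (q n))
    (hker : ∀ n, LinearMap.ker (q n) = J • ⊤)
    (hcomm : ∀ n z, d' n (q (n + 1) z) = q n (d n z))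
    (hloc : ∀ (m : Ideal Λ) [m.IsMaximal], J ≤ m → ∃ xs : List Λ, (∀ x ∈ xs, x ∈ J) ∧
      (Ideal.ofList xs).map (algebraMap Λ (Localization.AtPrime m)) =
        J.map (algebraMap Λ (Localization.AtPrime m)) ∧
      ∀ n, IsWeaklyRegular (LocalizedModule m.primeCompl (X n)) xs) :
    IsRigidSequence fun n => d' n := by
  intro i hi j hij
  apply exact_of_localized_maximal
  intro m hm
  by_cases hJm : J ≤ m
  · obtain ⟨xs, hxJ, hI, hreg⟩ := hloc m hJm
    let Λ' := Localization.AtPrime m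
    have hcomp : ∀ n, (LocalizedModule.map m.primeCompl (d' n)) ∘ₗ
        (LocalizedModule.map m.primeCompl (q (n + 1))) =
        (LocalizedModule.map m.primeCompl (q n)) ∘ₗ (LocalizedModule.map m.primeCompl (d n)) := by
      intro n
      ext z
      induction z using LocalizedModule.induction_on with
      | h z s =>
        simp only [LinearMap.comp_apply, LocalizedModule.map_mk, hcomm]
    have hrig : IsRigidSequence (X := fun n => LocalizedModule m.primeCompl (Q n))
        (fun n => LocalizedModule.map m.primeCompl (d' n)) := by
      refine IsRigidSequence.of_isWeaklyRegular (xs.map (algebraMap Λ Λ')) ?_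
        (d := fun n => LocalizedModule.map m.primeCompl (d n)) ?_
        (IsRigidSequence.of_exact_succ fun n => LocalizedModule.map_exact _ _ _ (hex n))
        (fun n => (isWeaklyRegular_map_algebraMap_iff Λ' _ xs).2 (hreg n))
        (q := fun n => LocalizedModule.map m.primeCompl (q n))
        ?_ ?_ (fun n => LinearMap.congr_fun (hcomp n))
      · intro x hx
        obtain ⟨y, hy, rfl⟩ := List.mem_map.1 hx
        rw [IsLocalRing.jacobson_eq_maximalIdeal ⊥ bot_ne_top]
        exact (Localization.AtPrime.under_maximalIdeal (I := m)).ge (hJm (hxJ y hy))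
      · intro n z
        induction z using LocalizedModule.induction_on with
        | h z s =>
          change LocalizedModule.map m.primeCompl (d n)
            (LocalizedModule.map m.primeCompl (d (n + 1)) (LocalizedModule.mk z s)) = 0
          rw [LocalizedModule.map_mk, LocalizedModule.map_mk, hd, LocalizedModule.zero_mk]
      · intro n
        exact IsLocalizedModule.map_surjective m.primeCompl (LocalizedModule.mkLinearMap _ _)
          (LocalizedModule.mkLinearMap _ _) _ (hq n)
      · intro n
        have := (LinearMap.localized'_ker_eq_ker_localizedMap Λ' m.primeCompl
          (LocalizedModule.mkLinearMap m.primeCompl (X n))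
          (LocalizedModule.mkLinearMap m.primeCompl (Q n)) (q n))
        refine this.symm.trans ?_
        rw [hker, Submodule.localized'_smul, Submodule.localized'_top, ← Ideal.map_ofList, hI]
        congr 1
        rw [Submodule.localized'_eq_span]
        rfl
    exact hrig i (LocalizedModule.map_exact _ _ _ hi) j hij
  -- An element of `J` outside `m` kills the quotient and becomes invertible at `m`.
  · have : Subsingleton (LocalizedModule m.primeCompl (Q (j + 1))) := by
      rw [LocalizedModule.subsingleton_iff]
      obtain ⟨r, hr, hrm⟩ := Set.not_subset.1 hJm
      intro y
      obtain ⟨z, rfl⟩ := hq _ y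
      refine ⟨r, hrm, ?_⟩
      rw [← map_smul, ← LinearMap.mem_ker, hker]
      exact Submodule.smul_mem_smul hr trivial
    intro y
    exact ⟨fun _ => ⟨0, Subsingleton.elim _ _⟩, fun _ => by rw [Subsingleton.elim y 0, map_zero]⟩

end Rigid

/-! ### Transport of weak regularity to localizations -/

/-- The localization of `Z` at `q` is a further localization of the one at `p`, and localization
preserves weak regularity. -/
theorem RingTheory.Sequence.IsWeaklyRegular.localizedModule_of_comap {S W Z : Type*} [CommRing S]
    [CommRing W] [Algebra S W] [AddCommGroup Z] [Module S Z] [Module W Z] [IsScalarTower S W Z]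
    {p : Ideal S} [p.IsPrime] {q : Ideal W} [q.IsPrime] (hpq : q.comap (algebraMap S W) = p)
    {xs : List S} (h : IsWeaklyRegular (LocalizedModule p.primeCompl Z) xs) :
    IsWeaklyRegular (LocalizedModule q.primeCompl Z) (xs.map (algebraMap S W)) := by
  let U := Algebra.algebraMapSubmonoid W p.primeCompl
  have hU : U ≤ q.primeCompl := by
    rintro _ ⟨s, hs, rfl⟩ hq
    exact hs (hpq ▸ hq)
  let f := LocalizedModule.mkLinearMap U Z
  have := IsLocalizedModule.restrictScalars p.primeCompl f
  let e := IsLocalizedModule.linearEquiv p.primeCompl (LocalizedModule.mkLinearMap p.primeCompl Z)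
    (f.restrictScalars S)
  rw [e.isWeaklyRegular_congr, ← isWeaklyRegular_map_algebraMap_iff W] at h
  have := h.of_isLocalizedModule (Localization.AtPrime q) q.primeCompl
    (LocalizedModule.liftOfLE U q.primeCompl (M := Z) hU)
  rwa [isWeaklyRegular_map_algebraMap_iff] at this

/-- The localization of `Z` is the free module `ι →₀ S` tensored with `S_p ⊗[R] M`, and tensoring
with a flat module preserves weak regularity. -/
theorem RingTheory.Sequence.IsWeaklyRegular.localizedModule_of_equiv {R S M Z ι : Type*}
    [CommRing R] [CommRing S] [Algebra R S] [AddCommGroup M] [Module R M] [AddCommGroup Z]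
    [Module S Z] (e : Z ≃ₗ[S] ι →₀ (S ⊗[R] M)) {p : Ideal S} [p.IsPrime] {xs : List S}
    (h : IsWeaklyRegular (Localization.AtPrime p ⊗[R] M) xs) :
    IsWeaklyRegular (LocalizedModule p.primeCompl Z) xs := by
  classical
  let e1 : (LocalizedModule p.primeCompl Z) ≃ₗ[S] Localization.AtPrime p ⊗[S] Z :=
    (LocalizedModule.equivTensorProduct p.primeCompl Z).restrictScalars S
  let e2 : Localization.AtPrime p ⊗[S] Z ≃ₗ[S]
      Localization.AtPrime p ⊗[S] ((ι →₀ S) ⊗[S] (S ⊗[R] M)) :=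
    (e.trans (TensorProduct.finsuppScalarLeft S (S ⊗[R] M) ι).symm).lTensor _
  let e3 := TensorProduct.leftComm S (Localization.AtPrime p) (ι →₀ S) (S ⊗[R] M)
  let e4 : Localization.AtPrime p ⊗[S] (S ⊗[R] M) ≃ₗ[S] Localization.AtPrime p ⊗[R] M :=
    TensorProduct.AlgebraTensorModule.cancelBaseChange R S S _ M
  exact (LinearEquiv.isWeaklyRegular_congr (M₂ := (ι →₀ S) ⊗[S] (Localization.AtPrime p ⊗[R] M))
    ((e1.trans e2).trans (e3.trans (e4.lTensor (ι →₀ S)))) xs).2 h.isWeaklyRegular_lTensor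

/-! ### Tensor products as modules over `A ⊗[K] E` -/

section Bimodule

variable (K A E R M P : Type*) [CommRing K] [CommRing A] [CommRing E] [CommRing R]
  [Algebra K A] [Algebra K E] [Algebra K R] [Algebra R A] [Algebra R E]
  [IsScalarTower K R A] [IsScalarTower K R E] [AddCommGroup M] [AddCommGroup P]
  [Module K M] [Module K P] [Module R M] [Module R P] [Module A M] [Module E P]
  [IsScalarTower K R M] [IsScalarTower K R P] [IsScalarTower R A M] [IsScalarTower R E P]

/-- The action of `A ⊗[K] E` on `M ⊗[R] P` through an action of `A` on `M` and of `E` on `P`. -/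
noncomputable def TensorProduct.actionHom : A ⊗[K] E →ₐ[K] Module.End R (M ⊗[R] P) :=
  Algebra.TensorProduct.lift
    (((Module.End.rTensorAlgHom R M P).comp (Algebra.lsmul R R M)).restrictScalars K)
    (((Module.End.lTensorAlgHom R P M).comp (Algebra.lsmul R R P)).restrictScalars K)
    fun a e => by
      rw [commute_iff_eq]
      ext m p
      rfl

variable {K A E R M P} in
@[simp]
theorem TensorProduct.actionHom_tmul_tmul (a : A) (e : E) (m : M) (p : P) :
    actionHom K A E R M P (a ⊗ₜ e) (m ⊗ₜ[R] p) = (a • m) ⊗ₜ[R] (e • p) := by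
  rw [actionHom, Algebra.TensorProduct.lift_tmul]
  rfl

/-- The action of `A ⊗[K] E` on `M ⊗[R] P` through an action of `A` on `M` and of `E` on `P`. -/
noncomputable abbrev TensorProduct.actionModule : Module (A ⊗[K] E) (M ⊗[R] P) :=
  Module.compHom _ (actionHom K A E R M P).toRingHom

end Bimodule

section Bimodule

variable {K A E R M P : Type*} [CommRing K] [CommRing A] [CommRing E] [CommRing R]
  [Algebra K A] [Algebra K E] [Algebra K R] [Algebra R A] [Algebra R E]
  [IsScalarTower K R A] [IsScalarTower K R E] [AddCommGroup M] [AddCommGroup P]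
  [Module K M] [Module K P] [Module R M] [Module R P] [Module A M] [Module E P]
  [IsScalarTower K R M] [IsScalarTower K R P] [IsScalarTower R A M] [IsScalarTower R E P]

attribute [local instance 50] TensorProduct.actionModule

namespace TensorProduct

theorem tmul_action_tmul (a : A) (e : E) (m : M) (p : P) :
    (a ⊗ₜ[K] e) • (m ⊗ₜ[R] p) = (a • m) ⊗ₜ[R] (e • p) :=
  actionHom_tmul_tmul a e m p

/-- `LinearMap.lTensor` as a linear map over `A ⊗[K] E`. -/
noncomputable def lTensorAction {P' : Type*} [AddCommGroup P'] [Module K P'] [Module R P']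
    [Module E P'] [IsScalarTower K R P'] [IsScalarTower R E P'] (f : P →ₗ[E] P') :
    M ⊗[R] P →ₗ[A ⊗[K] E] M ⊗[R] P' where
  __ := LinearMap.lTensor M ((f.restrictScalars R : P →ₗ[R] P'))
  map_smul' w z := by
    dsimp
    induction w with
    | zero => rw [zero_smul, zero_smul, map_zero]
    | add w w' h h' => rw [add_smul, map_add, h, h', add_smul]
    | tmul a e =>
      induction z with
      | zero => simp only [smul_zero, map_zero]
      | add z z' h h' => simp only [smul_add, map_add, h, h']
      | tmul m p =>
        rw [tmul_action_tmul, LinearMap.lTensor_tmul, LinearMap.lTensor_tmul, tmul_action_tmul]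
        exact congrArg _ (f.map_smul e p)

variable (K A E M P) [IsScalarTower K A M] [IsScalarTower K E P]

/-- The projection `M ⊗[K] P → M ⊗[R] P` as a linear map over `A ⊗[K] E`. -/
noncomputable def projAction : M ⊗[K] P →ₗ[A ⊗[K] E] M ⊗[R] P where
  __ := mapOfCompatibleSMul R K K M P
  map_smul' w z := by
    dsimp
    induction w with
    | zero => rw [zero_smul, zero_smul, map_zero]
    | add w w' h h' => rw [add_smul, map_add, h, h', add_smul]
    | tmul a e =>
      induction z with
      | zero => simp only [smul_zero, map_zero]
      | add z z' h h' => simp only [smul_add, map_add, h, h']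
      | tmul m p =>
        rw [tmul_action_tmul, mapOfCompatibleSMul_tmul, mapOfCompatibleSMul_tmul, tmul_action_tmul]

theorem projAction_surjective : Function.Surjective (projAction K A E (R := R) M P) :=
  mapOfCompatibleSMul_surjective R K K M P

omit [Module R P] [IsScalarTower K R P] [IsScalarTower R E P] [Algebra R E]
  [IsScalarTower K R A] [IsScalarTower K R E] in
theorem smul_eq_algebraMap_tmul_one_action (r : R) (z : M ⊗[K] P) :
    r • z = (algebraMap R A r ⊗ₜ[K] (1 : E)) • z := by
  induction z with
  | zero => rw [smul_zero, smul_zero]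
  | add z z' h h' => rw [smul_add, smul_add, h, h']
  | tmul m p => rw [tmul_action_tmul, smul_tmul', one_smul, algebraMap_smul]

variable (R) in
-- The relations `(r • m) ⊗ p - m ⊗ (r • p)` that cut out `M ⊗[R] P` are the products of the
-- generators `r ⊗ 1 - 1 ⊗ r` of the diagonal ideal with pure tensors.
theorem ker_projAction :
    LinearMap.ker (projAction K A E (R := R) M P) =
      (KaehlerDifferential.ideal K R).map (Algebra.TensorProduct.map
        (IsScalarTower.toAlgHom K R A) (IsScalarTower.toAlgHom K R E)) • ⊤ := by
  apply le_antisymm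
  · intro z hz
    have : z ∈ LinearMap.ker (mapOfCompatibleSMul R K R M P) := hz
    rw [AlgebraTensorModule.ker_mapOfCompatibleSMul] at this
    clear hz
    induction this using Submodule.span_induction with
    | zero => exact zero_mem _
    | add z z' _ _ h h' => exact add_mem h h'
    | smul r z _ h =>
      rw [smul_eq_algebraMap_tmul_one_action (A := A) (E := E)]
      exact Submodule.smul_mem _ _ h
    | mem z h =>
      obtain ⟨r, m, p, rfl⟩ := h
      have : (r • m) ⊗ₜ[K] p - m ⊗ₜ[K] (r • p) = Algebra.TensorProduct.map
          (IsScalarTower.toAlgHom K R A) (IsScalarTower.toAlgHom K R E)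
          (r ⊗ₜ 1 - 1 ⊗ₜ r) • m ⊗ₜ[K] p := by
        rw [map_sub, Algebra.TensorProduct.map_tmul, Algebra.TensorProduct.map_tmul, sub_smul,
          tmul_action_tmul, tmul_action_tmul]
        simp
      rw [this, ← neg_sub]
      exact Submodule.smul_mem_smul (Ideal.mem_map_of_mem _ (neg_mem
        (KaehlerDifferential.one_smul_sub_smul_one_mem_ideal K r))) trivial
  · rw [← KaehlerDifferential.span_range_eq_ideal, Ideal.map_span, Submodule.smul_le]
    intro w hw z _
    rw [LinearMap.mem_ker, map_smul]
    generalize projAction K A E (R := R) M P z = y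
    induction hw using Submodule.span_induction generalizing y with
    | zero => exact zero_smul _ _
    | add w w' _ _ h h' => rw [add_smul, h, h', add_zero]
    | smul v w _ h => rw [smul_eq_mul, mul_smul, h, smul_zero]
    | mem w hw =>
      obtain ⟨_, ⟨r, rfl⟩, rfl⟩ := hw
      induction y with
      | zero => exact smul_zero _
      | add y y' h h' => rw [smul_add, h, h', add_zero]
      | tmul m p =>
        rw [map_sub, Algebra.TensorProduct.map_tmul, Algebra.TensorProduct.map_tmul, sub_smul,
          tmul_action_tmul, tmul_action_tmul]
        simp [smul_tmul]

/-- If `P` is free over `R`, then `M ⊗[K] P` is, over `R ⊗[K] R`, a direct sum of copies of the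
extension of scalars of `M` along the left inclusion. -/
theorem nonempty_equiv_finsupp_action [Module.Free R P] :
    Nonempty (M ⊗[K] P ≃ₗ[R ⊗[K] R]
      Module.Free.ChooseBasisIndex R P →₀ ((R ⊗[K] R) ⊗[R] M)) := by
  classical
  let b := Module.Free.chooseBasis R P
  let e0 : M ⊗[K] R ≃ₗ[R] (R ⊗[K] R) ⊗[R] M :=
    ((AlgebraTensorModule.cancelBaseChange K R R M R).symm.trans
      (TensorProduct.comm R M (R ⊗[K] R)))
  let e1 : M ⊗[K] P ≃ₗ[R] M ⊗[K] (Module.Free.ChooseBasisIndex R P →₀ R) :=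
    AlgebraTensorModule.congr (.refl R M) (b.repr.restrictScalars K)
  let e := (e1.trans (TensorProduct.finsuppRight K R M R _)).trans
    (Finsupp.mapRange.linearEquiv e0)
  -- By construction `e` is only linear over the first factor; this formula on pure tensors yields
  -- linearity over both.
  have he (m : M) (p : P) (i) : e (m ⊗ₜ p) i = (1 ⊗ₜ[K] b.repr p i) ⊗ₜ[R] m := by
    simp [e, e1, e0]
  refine ⟨{ e with map_smul' := fun s z => ?_ }⟩
  dsimp
  induction s with
  | zero => rw [zero_smul, zero_smul, map_zero]
  | add w w' h h' => rw [add_smul, map_add, h, h', add_smul]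
  | tmul a c =>
    induction z with
    | zero => simp only [smul_zero, map_zero]
    | add z z' h h' => simp only [smul_add, map_add, h, h']
    | tmul m p =>
      rw [tmul_action_tmul]
      ext i
      rw [he, Finsupp.smul_apply, he]
      simp [smul_tmul']

variable (R) in
/-- The map `R ⊗[K] R → A ⊗[K] E` makes the actions on `M ⊗[K] P` compatible. -/
theorem map_action (s : R ⊗[K] R) (z : M ⊗[K] P) :
    Algebra.TensorProduct.map (IsScalarTower.toAlgHom K R A) (IsScalarTower.toAlgHom K R E) s • z =
      s • z := by
  induction s with
  | zero => rw [map_zero, zero_smul, zero_smul]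
  | add w w' h h' => rw [map_add, add_smul, h, h', add_smul]
  | tmul a c =>
    induction z with
    | zero => rw [smul_zero, smul_zero]
    | add z z' h h' => simp only [smul_add, h, h']
    | tmul m p =>
      rw [Algebra.TensorProduct.map_tmul, tmul_action_tmul, tmul_action_tmul]
      simp

omit [Module R M] [Module R P] [IsScalarTower K R M] [IsScalarTower K R P] [IsScalarTower R A M]
  [IsScalarTower R E P] [Algebra K R] [Algebra R A] [Algebra R E] [IsScalarTower K R A]
  [IsScalarTower K R E] in
theorem finite_action [Module.Finite A M] [Module.Finite E P] :
    Module.Finite (A ⊗[K] E) (M ⊗[K] P) := by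
  obtain ⟨s, hs⟩ := Module.Finite.fg_top (R := A) (M := M)
  obtain ⟨t, ht⟩ := Module.Finite.fg_top (R := E) (M := P)
  classical
  refine ⟨Finset.image₂ (fun m p => m ⊗ₜ[K] p) s t, eq_top_iff.2 fun z hz => ?_⟩
  clear hz
  induction z with
  | zero => exact zero_mem _
  | add z z' h h' => exact add_mem h h'
  | tmul m p =>
    have hm : m ∈ Submodule.span A (s : Set M) := hs ▸ trivial
    have hp : p ∈ Submodule.span E (t : Set P) := ht ▸ trivial
    induction hm using Submodule.span_induction with
    | zero => rw [zero_tmul]; exact zero_mem _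
    | add m m' _ _ h h' => rw [add_tmul]; exact add_mem h h'
    | smul a m _ h =>
      rw [← one_smul E p, ← tmul_action_tmul (K := K) (R := K)]
      exact Submodule.smul_mem _ _ h
    | mem m hm =>
      induction hp using Submodule.span_induction with
      | zero => rw [tmul_zero]; exact zero_mem _
      | add p p' _ _ h h' => rw [tmul_add]; exact add_mem h h'
      | smul e p _ h =>
        rw [← one_smul A m, ← tmul_action_tmul (K := K) (R := K)]
        exact Submodule.smul_mem _ _ h
      | mem p hp =>
        exact Submodule.subset_span (Finset.mem_coe.2 (Finset.mem_image₂_of_mem hm hp))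

end TensorProduct
end Bimodule

theorem Ideal.map_map_localization_eq {S W : Type*} [CommRing S] [CommRing W] (φ : S →+* W)
    {p : Ideal S} [p.IsPrime] {q : Ideal W} [q.IsPrime] (hpq : p = q.comap φ) {I L : Ideal S}
    (h : L.map (algebraMap S (Localization.AtPrime p)) =
      I.map (algebraMap S (Localization.AtPrime p))) :
    (L.map φ).map (algebraMap W (Localization.AtPrime q)) =
      (I.map φ).map (algebraMap W (Localization.AtPrime q)) := by
  have hψ : (Localization.localRingHom p q φ hpq).comp (algebraMap S (Localization.AtPrime p)) =
      (algebraMap W (Localization.AtPrime q)).comp φ :=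
    RingHom.ext fun s => Localization.localRingHom_to_map p q φ hpq s
  rw [Ideal.map_map, Ideal.map_map, ← hψ, ← Ideal.map_map, ← Ideal.map_map, h]

/-! ### Rigidity of `M ⊗[R] P` -/

section Bimodule

attribute [local instance 50] TensorProduct.actionModule

/-- Reduction to the diagonal: `M ⊗[R] P` is presented as `M ⊗[K] P` modulo the extended diagonal
ideal, and the local regular sequences come from the contractions of maximal ideals to `R ⊗[K] R`.
-/
theorem IsEssentiallySmooth.isRigidSequence_lTensor {K : Type v} [Field K] {R A E M : Type u}
    [CommRing R] [CommRing A] [CommRing E] [Algebra K R] [Algebra K A] [Algebra K E]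
    [Algebra R A] [Algebra R E] [IsScalarTower K R A] [IsScalarTower K R E]
    [Algebra.EssFiniteType K A] [Algebra.EssFiniteType K E] (hR : IsEssentiallySmooth K R)
    [AddCommGroup M] [Module K M] [Module R M] [Module A M] [IsScalarTower K R M]
    [IsScalarTower R A M] [Module.Finite A M] {P : ℕ → Type u} [∀ n, AddCommGroup (P n)]
    [∀ n, Module K (P n)] [∀ n, Module R (P n)] [∀ n, Module E (P n)]
    [∀ n, IsScalarTower K R (P n)] [∀ n, IsScalarTower R E (P n)] [∀ n, Module.Finite E (P n)]
    [∀ n, Module.Free R (P n)] (d : ∀ n, P (n + 1) →ₗ[E] P n)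
    (hd : ∀ n z, d n (d (n + 1) z) = 0) (hex : ∀ n, Function.Exact (d (n + 2)) (d (n + 1))) :
    IsRigidSequence (X := fun n => M ⊗[R] P n)
      fun n => LinearMap.lTensor M ((d n).restrictScalars R) := by
  have := hR.essFiniteType
  have : Algebra.EssFiniteType K (R ⊗[K] R) := .comp K R _
  have : IsNoetherianRing (R ⊗[K] R) := Algebra.EssFiniteType.isNoetherianRing K _
  have : Algebra.EssFiniteType K (A ⊗[K] E) := .comp K A _
  have : IsNoetherianRing (A ⊗[K] E) := Algebra.EssFiniteType.isNoetherianRing K _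
  have : IsScalarTower K A M := .to₁₃₄ K R A M
  have : ∀ n, IsScalarTower K E (P n) := fun n => .to₁₃₄ K R E (P n)
  have : ∀ n, Module.Finite (A ⊗[K] E) (M ⊗[K] P n) := fun n => TensorProduct.finite_action K A E M (P n)
  let φ : R ⊗[K] R →ₐ[K] A ⊗[K] E := Algebra.TensorProduct.map
    (IsScalarTower.toAlgHom K R A) (IsScalarTower.toAlgHom K R E)
  let _ : Algebra (R ⊗[K] R) (A ⊗[K] E) := φ.toRingHom.toAlgebra
  have : ∀ n, IsScalarTower (R ⊗[K] R) (A ⊗[K] E) (M ⊗[K] P n) := fun n =>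
    .of_algebraMap_smul fun r x => TensorProduct.map_action K A E R M (P n) r x
  refine IsRigidSequence.of_localization (Λ := A ⊗[K] E) ((KaehlerDifferential.ideal K R).map φ)
    (X := fun n => M ⊗[K] P n) (d := fun n => TensorProduct.lTensorAction (R := K) (d n))
    ?_ ?_ (Q := fun n => M ⊗[R] P n) (d' := fun n => TensorProduct.lTensorAction (R := R) (d n))
    (q := fun n => TensorProduct.projAction K A E M (P n))
    (fun n => TensorProduct.projAction_surjective K A E M (P n))
    (fun n => TensorProduct.ker_projAction K A E R M (P n)) ?_ ?_
  · intro n z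
    change ((d n).restrictScalars K).lTensor M (((d (n + 1)).restrictScalars K).lTensor M z) = 0
    rw [← LinearMap.lTensor_comp_apply, show (d n).restrictScalars K ∘ₗ (d (n + 1)).restrictScalars K
      = 0 from LinearMap.ext (hd n), LinearMap.lTensor_zero, LinearMap.zero_apply]
  · exact fun n => Module.Flat.lTensor_exact (R := K) M (f := (d (n + 2)).restrictScalars K)
      (g := (d (n + 1)).restrictScalars K) (hex n)
  · intro n z
    induction z with
    | zero => simp only [map_zero]
    | add z z' h h' => simp only [map_add, h, h']
    | tmul m p => rfl
  · intro m hm hJ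
    have hI : KaehlerDifferential.ideal K R ≤ m.comap (algebraMap (R ⊗[K] R) (A ⊗[K] E)) :=
      Ideal.map_le_iff_le_comap.1 hJ
    obtain ⟨xs, hxs, hmap, hreg⟩ := hR.exists_isWeaklyRegular_localization hI
    refine ⟨xs.map φ, ?_, ?_, fun n => ?_⟩
    · intro x hx
      obtain ⟨y, hy, rfl⟩ := List.mem_map.1 hx
      exact Ideal.mem_map_of_mem _ (hxs y hy)
    · have := Ideal.map_map_localization_eq (algebraMap (R ⊗[K] R) (A ⊗[K] E)) rfl hmap
      rw [Ideal.map_ofList] at this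
      exact this
    · obtain ⟨e⟩ := TensorProduct.nonempty_equiv_finsupp_action (K := K) (R := R) (M := M)
        (P := P n)
      exact ((hreg M).localizedModule_of_equiv e).localizedModule_of_comap rfl

end Bimodule

/-! ### Tor from an explicit resolution -/

section Resolution

variable {R : Type u} [CommRing R]

theorem ModuleCat.ofHom_comp_ofHom_eq_zero {X Y Z : Type u} [AddCommGroup X] [AddCommGroup Y]
    [AddCommGroup Z] [Module R X] [Module R Y] [Module R Z] {f : X →ₗ[R] Y} {g : Y →ₗ[R] Z}
    (h : Function.Exact f g) : ModuleCat.ofHom f ≫ ModuleCat.ofHom g = 0 := by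
  rw [← ModuleCat.ofHom_comp, h.linearMap_comp_eq_zero]
  rfl

/-- The chain complex of `R`-modules given by an unbundled sequence of maps. -/
noncomputable def ModuleCat.chainComplexOf {X : ℕ → Type u} [∀ n, AddCommGroup (X n)]
    [∀ n, Module R (X n)] (d : ∀ n, X (n + 1) →ₗ[R] X n)
    (h : ∀ n, Function.Exact (d (n + 1)) (d n)) : ChainComplex (ModuleCat.{u} R) ℕ :=
  ChainComplex.of (fun n => ModuleCat.of R (X n)) (fun n => ModuleCat.ofHom (d n)) fun n =>
    ModuleCat.ofHom_comp_ofHom_eq_zero (h n)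

theorem ModuleCat.chainComplexOf_d {X : ℕ → Type u} [∀ n, AddCommGroup (X n)]
    [∀ n, Module R (X n)] (d : ∀ n, X (n + 1) →ₗ[R] X n)
    (h : ∀ n, Function.Exact (d (n + 1)) (d n)) (n : ℕ) :
    (chainComplexOf d h).d (n + 1) n = ModuleCat.ofHom (d n) :=
  ChainComplex.of_d (X := fun n => ModuleCat.of R (X n)) (fun n => ModuleCat.ofHom (d n)) n

theorem ModuleCat.chainComplexOf_d_comp_ofHom {X : ℕ → Type u} [∀ n, AddCommGroup (X n)]
    [∀ n, Module R (X n)] {N : Type u} [AddCommGroup N] [Module R N]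
    {d : ∀ n, X (n + 1) →ₗ[R] X n} (h : ∀ n, Function.Exact (d (n + 1)) (d n))
    {ε : X 0 →ₗ[R] N} (h0 : Function.Exact (d 0) ε) :
    (chainComplexOf d h).d 1 0 ≫ ModuleCat.ofHom ε = 0 := by
  rw [chainComplexOf_d]
  exact ofHom_comp_ofHom_eq_zero h0

/-- The projective resolution given by an unbundled exact sequence of projective modules. -/
noncomputable def ModuleCat.projectiveResolutionOf {X : ℕ → Type u} [∀ n, AddCommGroup (X n)]
    [∀ n, Module R (X n)] [∀ n, Module.Projective R (X n)] {N : Type u} [AddCommGroup N]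
    [Module R N] (d : ∀ n, X (n + 1) →ₗ[R] X n) (h : ∀ n, Function.Exact (d (n + 1)) (d n))
    (ε : X 0 →ₗ[R] N) (hε : Function.Surjective ε) (h0 : Function.Exact (d 0) ε) :
    ProjectiveResolution (ModuleCat.of R N) where
  complex := chainComplexOf d h
  projective n := (IsProjective.iff_projective (X n)).1 inferInstance
  π := (ChainComplex.toSingle₀Equiv _ _).symm
    ⟨ModuleCat.ofHom ε, chainComplexOf_d_comp_ofHom h h0⟩
  quasiIso := ⟨fun n => by
    cases n
    · rw [ChainComplex.quasiIsoAt₀_iff, ShortComplex.quasiIso_iff_of_zeros']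
      · refine (ShortComplex.exact_and_epi_g_iff_of_iso (S₂ := ShortComplex.mk
          (ModuleCat.ofHom (d 0)) (ModuleCat.ofHom ε)
          (ModuleCat.ofHom_comp_ofHom_eq_zero h0)) ?_).2 ⟨?_, ?_⟩
        · exact ShortComplex.isoMk (Iso.refl _) (Iso.refl _) (Iso.refl _)
            ((Category.id_comp _).trans ((chainComplexOf_d d h 0).symm.trans
              (Category.comp_id _).symm))
            ((Category.id_comp _).trans (Eq.trans
              (ChainComplex.toSingle₀Equiv_symm_apply_f_zero (C := chainComplexOf d h)
                (ModuleCat.ofHom ε) (chainComplexOf_d_comp_ofHom h h0)).symm (Category.comp_id _).symm))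
        · exact (ShortComplex.ShortExact.moduleCat_exact_iff_function_exact _).2 h0
        · exact (ModuleCat.epi_iff_surjective _).2 hε
      all_goals rfl
    · rw [quasiIsoAt_iff_exactAt']
      · rename_i n
        rw [HomologicalComplex.exactAt_iff' _ (n + 1 + 1) (n + 1) n (by simp) (by simp),
          ShortComplex.ShortExact.moduleCat_exact_iff_function_exact]
        change Function.Exact ((chainComplexOf d h).d (n + 2) (n + 1)).hom
          ((chainComplexOf d h).d (n + 1) n).hom
        rw [chainComplexOf_d, chainComplexOf_d]
        exact h n
      · apply ChainComplex.exactAt_succ_single_obj⟩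

theorem ModuleCat.isZero_tor_succ_iff {X : ℕ → Type u} [∀ n, AddCommGroup (X n)]
    [∀ n, Module R (X n)] [∀ n, Module.Projective R (X n)] {M N : Type u} [AddCommGroup N]
    [Module R N] [AddCommGroup M] [Module R M]
    (d : ∀ n, X (n + 1) →ₗ[R] X n) (h : ∀ n, Function.Exact (d (n + 1)) (d n))
    (ε : X 0 →ₗ[R] N) (hε : Function.Surjective ε) (h0 : Function.Exact (d 0) ε) (n : ℕ) :
    Limits.IsZero (((Tor (ModuleCat.{u} R) (n + 1)).obj (ModuleCat.of R M)).obj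
      (ModuleCat.of R N)) ↔ Function.Exact ((d (n + 1)).lTensor M) ((d n).lTensor M) := by
  let F := (MonoidalCategory.tensoringLeft (ModuleCat.{u} R)).obj (ModuleCat.of R M)
  refine ((projectiveResolutionOf d h ε hε h0).isoLeftDerivedObj F (n + 1)).isZero_iff.trans ?_
  refine (HomologicalComplex.exactAt_iff_isZero_homology _ _).symm.trans ?_
  rw [HomologicalComplex.exactAt_iff' _ (n + 1 + 1) (n + 1) n (by simp) (by simp),
    ShortComplex.ShortExact.moduleCat_exact_iff_function_exact]
  change Function.Exact (F.map ((chainComplexOf d h).d (n + 2) (n + 1))).hom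
    (F.map ((chainComplexOf d h).d (n + 1) n)).hom ↔ _
  rw [chainComplexOf_d, chainComplexOf_d]
  rfl

theorem ModuleCat.isZero_tor_zero_iff {X : ℕ → Type u} [∀ n, AddCommGroup (X n)]
    [∀ n, Module R (X n)] [∀ n, Module.Projective R (X n)] {M N : Type u} [AddCommGroup N]
    [Module R N] [AddCommGroup M] [Module R M]
    (d : ∀ n, X (n + 1) →ₗ[R] X n) (h : ∀ n, Function.Exact (d (n + 1)) (d n))
    (ε : X 0 →ₗ[R] N) (hε : Function.Surjective ε) (h0 : Function.Exact (d 0) ε) :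
    Limits.IsZero (((Tor (ModuleCat.{u} R) 0).obj (ModuleCat.of R M)).obj
      (ModuleCat.of R N)) ↔ Function.Surjective ((d 0).lTensor M) := by
  let F := (MonoidalCategory.tensoringLeft (ModuleCat.{u} R)).obj (ModuleCat.of R M)
  refine ((projectiveResolutionOf d h ε hε h0).isoLeftDerivedObj F 0).isZero_iff.trans ?_
  refine (HomologicalComplex.exactAt_iff_isZero_homology _ _).symm.trans ?_
  rw [HomologicalComplex.exactAt_iff' _ 1 0 0 (by simp) (by simp),
    ShortComplex.ShortExact.moduleCat_exact_iff_function_exact]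
  change Function.Exact (F.map ((chainComplexOf d h).d 1 0)).hom
    (F.map ((chainComplexOf d h).d 0 0)).hom ↔ _
  -- The complex has zero differential out of degree zero, so exactness there means surjectivity.
  rw [chainComplexOf_d, (chainComplexOf d h).shape 0 0 (by simp), F.map_zero]
  exact ⟨fun H y => (H y).1 rfl, fun H y => ⟨fun _ => H y, fun _ => rfl⟩⟩

/-- `Tor` from a projective resolution that is indexed with a shift by one, so that the vanishing
of `Tor` is exactness at the same place in each degree. -/
theorem ModuleCat.isZero_tor_iff {X : ℕ → Type u} [∀ n, AddCommGroup (X n)]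
    [∀ n, Module R (X n)] [∀ n, Module.Projective R (X n)] [Subsingleton (X 0)] {M N : Type u}
    [AddCommGroup N] [Module R N] [AddCommGroup M] [Module R M]
    (d : ∀ n, X (n + 1) →ₗ[R] X n) (h : ∀ n, Function.Exact (d (n + 2)) (d (n + 1)))
    (ε : X 1 →ₗ[R] N) (hε : Function.Surjective ε) (h0 : Function.Exact (d 1) ε) (n : ℕ) :
    Limits.IsZero (((Tor (ModuleCat.{u} R) n).obj (ModuleCat.of R M)).obj
      (ModuleCat.of R N)) ↔ Function.Exact ((d (n + 1)).lTensor M) ((d n).lTensor M) := by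
  cases n with
  | zero =>
    refine (isZero_tor_zero_iff (X := fun n => X (n + 1)) (fun n => d (n + 1)) h ε hε h0).trans ?_
    exact ⟨fun H y => ⟨fun _ => H y, fun _ => Subsingleton.elim _ _⟩,
      fun H y => (H y).1 (Subsingleton.elim _ _)⟩
  | succ n =>
    exact isZero_tor_succ_iff (X := fun n => X (n + 1)) (fun n => d (n + 1)) h ε hε h0 n

end Resolution

/-! ### Resolutions by modules finite over `E` and free over `R` -/

/-- The resolution starts at index 1. The zero module at index 0 makes vanishing of `Tor_0` an
exactness condition like the others. -/
theorem Module.exists_finite_free_resolution (E : Type u) [CommRing E] [IsNoetherianRing E]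
    (N : Type u) [AddCommGroup N] [Module E N] [Module.Finite E N] :
    ∃ (k : ℕ → ℕ) (d : ∀ n, (Fin (k (n + 1)) → E) →ₗ[E] (Fin (k n) → E))
      (ε : (Fin (k 1) → E) →ₗ[E] N), k 0 = 0 ∧ Function.Surjective ε ∧ Function.Exact (d 1) ε ∧
      ∀ n, Function.Exact (d (n + 2)) (d (n + 1)) := by
  have step {X : Type u} [AddCommGroup X] [Module E X] {a : ℕ} (f : (Fin a → E) →ₗ[E] X) :
      ∃ (b : ℕ) (g : (Fin b → E) →ₗ[E] (Fin a → E)), Function.Exact g f := by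
    obtain ⟨b, g, hg⟩ := Module.Finite.exists_fin' E (LinearMap.ker f)
    refine ⟨b, (LinearMap.ker f).subtype ∘ₗ g, ?_⟩
    rw [LinearMap.exact_iff, LinearMap.range_comp, LinearMap.range_eq_top.2 hg,
      Submodule.map_top, Submodule.range_subtype]
  obtain ⟨a, ε, hε⟩ := Module.Finite.exists_fin' E N
  obtain ⟨b, g, hg⟩ := step ε
  choose nb ng hng using fun (s : Σ' (a b : ℕ), (Fin b → E) →ₗ[E] (Fin a → E)) => step s.2.2
  -- The state is a map with the ranks of its target and source; the next state is a finite free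
  -- cover of its kernel.
  let s (n : ℕ) : Σ' (a b : ℕ), (Fin b → E) →ₗ[E] (Fin a → E) :=
    Nat.rec ⟨a, b, g⟩ (fun _ s => ⟨s.2.1, nb s, ng s⟩) n
  exact ⟨fun | 0 => 0 | n + 1 => (s n).1, fun | 0 => 0 | n + 1 => (s n).2.2, ε, rfl, hε, hg,
    fun n => hng (s n)⟩

/-- A module which is essentially of finite type over a `K`-algebra `R` is finite over an
`R`-algebra that is essentially of finite type over `K` and free as an `R`-module. -/
theorem IsEssentiallyOfFiniteType.exists_free {K : Type v} [Field K] {R : Type u} [CommRing R]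
    [Algebra K R] [Algebra.EssFiniteType K R] {N : Type u} [AddCommGroup N] [Module R N]
    (hN : IsEssentiallyOfFiniteType R N) :
    ∃ (E : Type u) (_ : CommRing E) (_ : Algebra K E) (_ : Algebra R E) (_ : Module E N),
      IsScalarTower K R E ∧ Algebra.EssFiniteType K E ∧ Module.Free R E ∧ Module.Finite E N ∧
      IsScalarTower R E N := by
  obtain ⟨B, _, _, _, _, _, _⟩ := hN
  let _ : Algebra K B := Algebra.compHom B (algebraMap K R)
  have : IsScalarTower K R B := .of_algebraMap_eq' rfl
  have : Algebra.EssFiniteType K B := .comp K R B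
  -- `R ⊗[K] B` is free over `R`, being a base change of a `K`-vector space, and it acts on `N`
  -- through this surjection onto `B`.
  let φ : R ⊗[K] B →ₐ[R] B := Algebra.TensorProduct.lift (Algebra.ofId R B) (AlgHom.id K B)
    fun _ _ => Commute.all _ _
  have hφ : Function.Surjective φ := fun b => ⟨1 ⊗ₜ b, by simp [φ]⟩
  let _ : Algebra (R ⊗[K] B) B := φ.toRingHom.toAlgebra
  let _ : Module (R ⊗[K] B) N := Module.compHom N φ.toRingHom
  have : IsScalarTower (R ⊗[K] B) B N := .of_algebraMap_smul fun _ _ => rfl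
  have : Module.Finite (R ⊗[K] B) B :=
    .of_surjective (Algebra.linearMap (R ⊗[K] B) B) hφ
  refine ⟨R ⊗[K] B, inferInstance, inferInstance, inferInstance, inferInstance, inferInstance,
    .comp K R _, inferInstance, .trans B N, .of_algebraMap_smul fun r n => ?_⟩
  change φ (algebraMap R (R ⊗[K] B) r) • n = r • n
  rw [AlgHom.commutes, algebraMap_smul]

end

theorem theorem1p1 (K : Type v) [Field K] (R : Type u) [CommRing R] [Algebra K R]
    (hR : IsEssentiallySmooth K R)
    (M N : Type u) [AddCommGroup M] [Module R M] [AddCommGroup N] [Module R N]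
    (hM : IsEssentiallyOfFiniteType R M) (hN : IsEssentiallyOfFiniteType R N)
    (i : ℕ)
    (hi : Limits.IsZero (((Tor (ModuleCat.{u} R) i).obj (ModuleCat.of R M)).obj
      (ModuleCat.of R N))) :
    ∀ j : ℕ, i ≤ j →
      Limits.IsZero (((Tor (ModuleCat.{u} R) j).obj (ModuleCat.of R M)).obj
        (ModuleCat.of R N)) := by
  have := hR.essFiniteType
  -- Only the resolved module `N` needs an algebra that is free over `R`; for `M` the given `A`
  -- suffices.
  obtain ⟨E, _, _, _, _, _, _, _, _, _⟩ := hN.exists_free (K := K)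
  obtain ⟨A, _, _, _, _, _, _⟩ := hM
  let _ : Algebra K A := Algebra.compHom A (algebraMap K R)
  have : IsScalarTower K R A := .of_algebraMap_eq' rfl
  have : Algebra.EssFiniteType K A := .comp K R A
  let _ : Module K M := Module.compHom M (algebraMap K R)
  have : IsScalarTower K R M := .of_algebraMap_smul fun _ _ => rfl
  have := Algebra.EssFiniteType.isNoetherianRing K E
  obtain ⟨k, d, ε, hk, hε, h0, hd⟩ := Module.exists_finite_free_resolution E N
  have : IsEmpty (Fin (k 0)) := by rw [hk]; infer_instance
  have hrigid : IsRigidSequence (X := fun n => M ⊗[R] (Fin (k n) → E))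
      fun n => ((d n).restrictScalars R).lTensor M := by
    refine hR.isRigidSequence_lTensor (A := A) (P := fun n => Fin (k n) → E) d (fun n z => ?_) hd
    cases n with
    | zero => exact Subsingleton.elim _ _
    | succ n => exact (hd n).apply_apply_eq_zero z
  have key (n : ℕ) := ModuleCat.isZero_tor_iff (M := M) (X := fun n => Fin (k n) → E)
    (fun n => (d n).restrictScalars R) hd (ε.restrictScalars R) hε h0 n
  exact fun j hij => (key j).2 (hrigid i ((key i).1 hi) j hij)
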